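/- **Setting.** For each $n\ge 1$ there are $n$ participants. Participant $i$ has potential outcomes $Y_i(1),Y_i(0)\in\mathbb R$, potential treatment decisions $D_i(1),D_i(0)\in\{0,1\}$ and covariates $Z_i\in\mathcal Z$; $S_i=S(Z_i)$ is its stratum, for a fixed function $S:\mathcal Z\to\mathcal S$ into a finite set $\mathcal S$; $A_i\in\{0,1\}$ is its treatment assignment. One observes $D_i=D_i(1)A_i+D_i(0)(1-A_i)$ and $Y_i=Y_i(1)D_i+Y_i(0)(1-D_i)$, together with $A_i$ and $Z_i$. Write $W^{(n)}=\{(Y_i(1),Y_i(0),D_i(0),D_i(1),Z_i)\}_{i=1}^n$, $A^{(n)}=\{A_i\}_{i=1}^n$, $S^{(n)}=\{S_i\}_{i=1}^n$. Let $C$, $AT$, $NT$ denote the events $\{D(0)=0,D(1)=1\}$, $\{D(0)=D(1)=1\}$, $\{D(0)=D(1)=0\}$, and for $s\in\mathcal S$, $a\in\{0,1\}$ put $p(s)=P(S_i=s)$, $\pi_{D(a)}(s)=P(D_i(a)=1\mid S_i=s)$, $n(s)=\sum_{i}1[S_i=s]$, $n_A(s)=\sum_i 1[A_i=1,S_i=s]$,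 $n_D(s)=\sum_i 1[D_i=1,S_i=s]$, $n_{AD}(s)=\sum_i 1[A_i=1,D_i=1,S_i=s]$. **Assumption 1.** $W^{(n)}$ is an i.i.d. sample from a law that does not depend on $n$, with (a) $E[Y_i(d)^2]<\infty$ for $d\in\{0,1\}$; (b) $p(s)>0$ for all $s$; (c) $P(D_i(0)=1,D_i(1)=0)=0$; (d) $\pi_{D(1)}(s)-\pi_{D(0)}(s)>0$ for all $s$. **Assumption 2.** (a) $W^{(n)}$ and $A^{(n)}$ are conditionally independent given $S^{(n)}$; (b) $n_A(s)/n(s)\overset{p}{\to}\pi_A(s)\in(0,1)$ for all $s$. **Target.** Let $\beta=E[Y(1)-Y(0)\mid C]$, $\beta(s)=E[Y(1)-Y(0)\mid C,S=s]$, $P(C)=\sum_{s}p(s)(\pi_{D(1)}(s)-\pi_{D(0)}(s))$, $\Delta_1(s)=E[Y(1)|C,S=s]-E[Y(1)|AT,S=s]$, $\Delta_0(s)=E[Y(0)|C,S=s]-E[Y(0)|NT,S=s]$, and $V_{\mathrm{sat}}=V_{Y,1}+V_{Y,0}+V_{D,1}+V_{D,0}+V_H$ with $$V_{Y,1}=\tfrac1{P(C)^2}\sum_s\tfrac{p(s)}{\pi_A(s)}\Big[V[Y(1)|AT,S=s]\,\pi_{D(0)}(s)+V[Y(0)|NT,S=s](1-\pi_{D(1)}(s))+V[Y(1)|C,S=s](\pi_{D(1)}(s)-\pi_{D(0)}(s))+\Delta_1(s)^2\,\tfrac{\pi_{D(0)}(s)(\pi_{D(1)}(s)-\pi_{D(0)}(s))}{\pi_{D(1)}(s)}\Big],$$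 $$V_{Y,0}=\tfrac1{P(C)^2}\sum_s\tfrac{p(s)}{1-\pi_A(s)}\Big[V[Y(1)|AT,S=s]\,\pi_{D(0)}(s)+V[Y(0)|NT,S=s](1-\pi_{D(1)}(s))+V[Y(0)|C,S=s](\pi_{D(1)}(s)-\pi_{D(0)}(s))+\Delta_0(s)^2\,\tfrac{(1-\pi_{D(1)}(s))(\pi_{D(1)}(s)-\pi_{D(0)}(s))}{1-\pi_{D(0)}(s)}\Big],$$ $$V_{D,1}=\tfrac1{P(C)^2}\sum_s\tfrac{p(s)(1-\pi_{D(1)}(s))}{\pi_A(s)\pi_{D(1)}(s)}\Big[-\pi_{D(0)}(s)\Delta_1(s)+\pi_{D(1)}(s)\Delta_0(s)+\pi_{D(1)}(s)(\beta(s)-\beta)\Big]^2,$$ $$V_{D,0}=\tfrac1{P(C)^2}\sum_s\tfrac{p(s)\pi_{D(0)}(s)}{(1-\pi_A(s))(1-\pi_{D(0)}(s))}\Big[-(1-\pi_{D(0)}(s))\Delta_1(s)+(1-\pi_{D(1)}(s))\Delta_0(s)+(1-\pi_{D(0)}(s))(\beta(s)-\beta)\Big]^2,$$ $$V_H=\tfrac1{P(C)^2}\sum_s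 p(s)(\pi_{D(1)}(s)-\pi_{D(0)}(s))^2(\beta(s)-\beta)^2.$$ If $\pi_{D(0)}(s)=0$ (resp. $\pi_{D(1)}(s)=1$), the conditional moments given $AT,S=s$ (resp. $NT,S=s$) are undefined, but their products with $\pi_{D(0)}(s)$ (resp. $1-\pi_{D(1)}(s)$) are set to $0$. **Estimator.** Let $X_i=(\{1[S_i=s]\}_s,\{D_i1[S_i=s]\}_s)$ and $\mathsf Z_i=(\{1[S_i=s]\}_s,\{A_i1[S_i=s]\}_s)$ be the rows of $\mathbf X_n$, $\mathbf Z_n$, let $\mathbf Y_n=(Y_1,\dots,Y_n)'$, and define $(\{\hat\gamma_{\mathrm{sat}}(s)\}_s,\{\hat\beta_{\mathrm{sat}}(s)\}_s)=(\mathbf Z_n'\mathbf X_n)^{-1}\mathbf Z_n'\mathbf Y_n$. Put $r_1(s)=\frac{n_{AD}(s)}{n_A(s)}$, $r_0(s)=\frac{n_D(s)-n_{AD}(s)}{n(s)-n_A(s)}$, $$\hat P(S=s,C)=\tfrac{n(s)}n(r_1(s)-r_0(s)),\quad \hat P(C)=\sum_s\hat P(S=s,C),\quad \hat\beta_{\mathrm{sat}}=\sum_s\tfrac{\hat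 P(S=s,C)}{\hat P(C)}\hat\beta_{\mathrm{sat}}(s),\quad \hat\delta(s)=\hat\beta_{\mathrm{sat}}(s)-\hat\beta_{\mathrm{sat}},$$ $$\hat u_i=Y_i-\sum_s 1[S_i=s]\hat\gamma_{\mathrm{sat}}(s)-\sum_s D_i1[S_i=s]\hat\beta_{\mathrm{sat}}(s),$$ $$\hat V_1=\tfrac1{\hat P(C)^2}\sum_s\Big(\tfrac{n(s)}{n_A(s)}\Big)^2\Big[\tfrac1n\sum_i1[D_i=1,A_i=1,S_i=s]\big(\hat u_i+(1-r_1(s))\hat\delta(s)\big)^2+\tfrac1n\sum_i1[D_i=0,A_i=1,S_i=s]\big(\hat u_i-r_1(s)\hat\delta(s)\big)^2\Big],$$ $$\hat V_0=\tfrac1{\hat P(C)^2}\sum_s\Big(\tfrac{n(s)}{n(s)-n_A(s)}\Big)^2\Big[\tfrac1n\sum_i1[D_i=1,A_i=0,S_i=s]\big(\hat u_i+(1-r_0(s))\hat\delta(s)\big)^2+\tfrac1n\sum_i1[D_i=0,A_i=0,S_i=s]\big(\hat u_i-r_0(s)\hat\delta(s)\big)^2\Big],$$ $$\hat V_H=\tfrac1{\hat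 P(C)^2}\sum_s\tfrac{n(s)}n(r_1(s)-r_0(s))^2\,\hat\delta(s)^2.$$ Where a denominator vanishes or $\mathbf Z_n'\mathbf X_n$ is singular, the quotient or inverse is set to $0$. **Theorem.** Under Assumptions 1 and 2, $\hat V_{\mathrm{sat}}=\hat V_1+\hat V_0+\hat V_H\overset{p}{\to}V_{\mathrm{sat}}$ as $n\to\infty$. -/

import Mathlib

open MeasureTheory ProbabilityTheory Filter Topology

namespace SatIV

/-- The underlying variables `(Y(·), D(·), Z)` of one participant: the potential outcomes
`Y(d)`, the potential treatment decisions `D(a)` and the baseline covariates `Z`.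
The value `true` stands for `1` and `false` for `0`. -/
abbrev Participant (𝒵 : Type*) : Type _ := (Bool → ℝ) × (Bool → Bool) × 𝒵

section Population

variable {𝒵 𝒮 : Type*}

/-- The potential outcome `Y(d)`. -/
def potY (d : Bool) (w : Participant 𝒵) : ℝ := w.1 d

/-- The potential treatment decision `D(a)`. -/
def potD (a : Bool) (w : Participant 𝒵) : Bool := w.2.1 a

/-- The stratum `S(Z)` of a participant. -/
def stratum (S : 𝒵 → 𝒮) (w : Participant 𝒵) : 𝒮 := S w.2.2

/-- The event `{S = s}`. -/
def inStratum (S : 𝒵 → 𝒮) (s : 𝒮) : Set (Participant 𝒵) := {w | stratum S w = s}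

/-- Compliers. -/
def compliers (𝒵 : Type*) : Set (Participant 𝒵) := {w | potD false w = false ∧ potD true w = true}

/-- Always takers. -/
def alwaysTakers (𝒵 : Type*) : Set (Participant 𝒵) :=
  {w | potD false w = true ∧ potD true w = true}

/-- Never takers. -/
def neverTakers (𝒵 : Type*) : Set (Participant 𝒵) :=
  {w | potD false w = false ∧ potD true w = false}

/-- Defiers. -/
def defiers (𝒵 : Type*) : Set (Participant 𝒵) := {w | potD false w = true ∧ potD true w = false}

variable [MeasurableSpace 𝒵]

/-- `E[f | E]`, the mean of `f` under `Q` conditioned on the event `E`. If `Q E = 0` this is `0`. -/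
noncomputable def condMean (Q : Measure (Participant 𝒵)) (f : Participant 𝒵 → ℝ)
    (E : Set (Participant 𝒵)) : ℝ := ∫ w, f w ∂(ProbabilityTheory.cond Q E)

/-- `V[f | E]`, the variance of `f` under `Q` conditioned on the event `E`.
If `Q E = 0` this is `0`. -/
noncomputable def condVar (Q : Measure (Participant 𝒵)) (f : Participant 𝒵 → ℝ)
    (E : Set (Participant 𝒵)) : ℝ := ProbabilityTheory.variance f (ProbabilityTheory.cond Q E)

/-- `p(s) = P(S = s)`. -/
noncomputable def p (Q : Measure (Participant 𝒵)) (S : 𝒵 → 𝒮) (s : 𝒮) : ℝ :=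
  Q.real (inStratum S s)

/-- `π_{D(a)}(s) = P(D(a) = 1 | S = s)`. -/
noncomputable def piD (Q : Measure (Participant 𝒵)) (S : 𝒵 → 𝒮) (a : Bool) (s : 𝒮) : ℝ :=
  (ProbabilityTheory.cond Q (inStratum S s)).real {w | potD a w = true}

/-- `E[Y(d) | T, S = s]` for a set `T` of participant types. -/
noncomputable def meanY (Q : Measure (Participant 𝒵)) (S : 𝒵 → 𝒮) (d : Bool)
    (T : Set (Participant 𝒵)) (s : 𝒮) : ℝ := condMean Q (potY d) (T ∩ inStratum S s)

/-- `V[Y(d) | T, S = s]` for a set `T` of participant types. -/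
noncomputable def varY (Q : Measure (Participant 𝒵)) (S : 𝒵 → 𝒮) (d : Bool)
    (T : Set (Participant 𝒵)) (s : 𝒮) : ℝ := condVar Q (potY d) (T ∩ inStratum S s)

/-- The local average treatment effect `β = E[Y(1) - Y(0) | C]`. -/
noncomputable def late (Q : Measure (Participant 𝒵)) : ℝ :=
  condMean Q (fun w => potY true w - potY false w) (compliers 𝒵)

/-- The stratum-specific effect `β(s) = E[Y(1) - Y(0) | C, S = s]`. -/
noncomputable def lateAt (Q : Measure (Participant 𝒵)) (S : 𝒵 → 𝒮) (s : 𝒮) : ℝ :=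
  condMean Q (fun w => potY true w - potY false w) (compliers 𝒵 ∩ inStratum S s)

variable [Fintype 𝒮]

/-- `P(C) = ∑ₛ p(s) (π_{D(1)}(s) - π_{D(0)}(s))`. -/
noncomputable def probC (Q : Measure (Participant 𝒵)) (S : 𝒵 → 𝒮) : ℝ :=
  ∑ s, p Q S s * (piD Q S true s - piD Q S false s)

/-- `V_{Y,1}`. -/
noncomputable def VY1 (Q : Measure (Participant 𝒵)) (S : 𝒵 → 𝒮) (πA : 𝒮 → ℝ) : ℝ :=
  1 / probC Q S ^ 2 * ∑ s, p Q S s / πA s *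
    (varY Q S true (alwaysTakers 𝒵) s * piD Q S false s
      + varY Q S false (neverTakers 𝒵) s * (1 - piD Q S true s)
      + varY Q S true (compliers 𝒵) s * (piD Q S true s - piD Q S false s)
      + (meanY Q S true (compliers 𝒵) s - meanY Q S true (alwaysTakers 𝒵) s) ^ 2
        * (piD Q S false s * (piD Q S true s - piD Q S false s) / piD Q S true s))

/-- `V_{Y,0}`. -/
noncomputable def VY0 (Q : Measure (Participant 𝒵)) (S : 𝒵 → 𝒮) (πA : 𝒮 → ℝ) : ℝ :=
  1 / probC Q S ^ 2 * ∑ s, p Q S s / (1 - πA s) *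
    (varY Q S true (alwaysTakers 𝒵) s * piD Q S false s
      + varY Q S false (neverTakers 𝒵) s * (1 - piD Q S true s)
      + varY Q S false (compliers 𝒵) s * (piD Q S true s - piD Q S false s)
      + (meanY Q S false (compliers 𝒵) s - meanY Q S false (neverTakers 𝒵) s) ^ 2
        * ((1 - piD Q S true s) * (piD Q S true s - piD Q S false s) / (1 - piD Q S false s)))

/-- `V_{D,1}`. -/
noncomputable def VD1 (Q : Measure (Participant 𝒵)) (S : 𝒵 → 𝒮) (πA : 𝒮 → ℝ) : ℝ :=
  1 / probC Q S ^ 2 * ∑ s, p Q S s * (1 - piD Q S true s) / (πA s * piD Q S true s) *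
    (-piD Q S false s * (meanY Q S true (compliers 𝒵) s - meanY Q S true (alwaysTakers 𝒵) s)
      + piD Q S true s * (meanY Q S false (compliers 𝒵) s - meanY Q S false (neverTakers 𝒵) s)
      + piD Q S true s * (lateAt Q S s - late Q)) ^ 2

/-- `V_{D,0}`. -/
noncomputable def VD0 (Q : Measure (Participant 𝒵)) (S : 𝒵 → 𝒮) (πA : 𝒮 → ℝ) : ℝ :=
  1 / probC Q S ^ 2 * ∑ s, p Q S s * piD Q S false s / ((1 - πA s) * (1 - piD Q S false s)) *
    (-(1 - piD Q S false s)
        * (meanY Q S true (compliers 𝒵) s - meanY Q S true (alwaysTakers 𝒵) s)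
      + (1 - piD Q S true s)
        * (meanY Q S false (compliers 𝒵) s - meanY Q S false (neverTakers 𝒵) s)
      + (1 - piD Q S false s) * (lateAt Q S s - late Q)) ^ 2

/-- `V_H`. -/
noncomputable def VH (Q : Measure (Participant 𝒵)) (S : 𝒵 → 𝒮) : ℝ :=
  1 / probC Q S ^ 2 * ∑ s, p Q S s * (piD Q S true s - piD Q S false s) ^ 2
    * (lateAt Q S s - late Q) ^ 2

/-- The asymptotic variance `V_sat = V_{Y,1} + V_{Y,0} + V_{D,1} + V_{D,0} + V_H`. -/
noncomputable def Vsat (Q : Measure (Participant 𝒵)) (S : 𝒵 → 𝒮) (πA : 𝒮 → ℝ) : ℝ :=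
  VY1 Q S πA + VY0 Q S πA + VD1 Q S πA + VD0 Q S πA + VH Q S

end Population

/-- The observed data of `n` participants: outcomes, treatment decisions, treatment assignments
and strata. -/
structure Sample (n : ℕ) (𝒮 : Type*) where
  Y : Fin n → ℝ
  D : Fin n → Bool
  A : Fin n → Bool
  S : Fin n → 𝒮

/-- The observed data generated by the underlying variables `w` and the assignments `a`:
`Dᵢ = Dᵢ(Aᵢ)`, `Yᵢ = Yᵢ(Dᵢ)` and `Sᵢ = S(Zᵢ)`. -/
def observe {𝒵 𝒮 : Type*} {n : ℕ} (S : 𝒵 → 𝒮) (w : Fin n → Participant 𝒵) (a : Fin n → Bool) :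
    Sample n 𝒮 where
  Y i := potY (potD (a i) (w i)) (w i)
  D i := potD (a i) (w i)
  A := a
  S i := stratum S (w i)

namespace Sample

variable {n : ℕ} {𝒮 : Type*} [DecidableEq 𝒮] (x : Sample n 𝒮)

/-- `n(s)`. -/
noncomputable def nS (s : 𝒮) : ℝ := ∑ i, if x.S i = s then 1 else 0

/-- `n_A(s)`. -/
noncomputable def nA (s : 𝒮) : ℝ := ∑ i, if x.A i = true ∧ x.S i = s then 1 else 0

/-- `n_D(s)`. -/
noncomputable def nD (s : 𝒮) : ℝ := ∑ i, if x.D i = true ∧ x.S i = s then 1 else 0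

/-- `n_AD(s)`. -/
noncomputable def nAD (s : 𝒮) : ℝ :=
  ∑ i, if x.A i = true ∧ x.D i = true ∧ x.S i = s then 1 else 0

/-- `n_AD(s) / n_A(s)`, the share of treated among those assigned to treatment. -/
noncomputable def r1 (s : 𝒮) : ℝ := x.nAD s / x.nA s

/-- `(n_D(s) - n_AD(s)) / (n(s) - n_A(s))`, the share of treated among those assigned to
control. -/
noncomputable def r0 (s : 𝒮) : ℝ := (x.nD s - x.nAD s) / (x.nS s - x.nA s)

/-- The regressors: stratum indicators, and stratum indicators interacted with `Dᵢ`. -/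
noncomputable def matX : Matrix (Fin n) (𝒮 ⊕ 𝒮) ℝ := Matrix.of fun i j =>
  match j with
  | Sum.inl s => if x.S i = s then 1 else 0
  | Sum.inr s => if x.D i = true ∧ x.S i = s then 1 else 0

/-- The instruments: stratum indicators, and stratum indicators interacted with `Aᵢ`. -/
noncomputable def matZ : Matrix (Fin n) (𝒮 ⊕ 𝒮) ℝ := Matrix.of fun i j =>
  match j with
  | Sum.inl s => if x.S i = s then 1 else 0
  | Sum.inr s => if x.A i = true ∧ x.S i = s then 1 else 0

variable [Fintype 𝒮]

/-- The vector of IV coefficients `(Z'X)⁻¹ (Z'Y)`. -/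
noncomputable def ivCoef : 𝒮 ⊕ 𝒮 → ℝ :=
  Matrix.mulVec (x.matZ.transpose * x.matX)⁻¹ (Matrix.mulVec x.matZ.transpose x.Y)

/-- The IV coefficient `γ̂(s)` on `I{Sᵢ = s}`. -/
noncomputable def gammaHatAt (s : 𝒮) : ℝ := x.ivCoef (Sum.inl s)

/-- The IV coefficient `β̂(s)` on `Dᵢ I{Sᵢ = s}`. -/
noncomputable def betaHatAt (s : 𝒮) : ℝ := x.ivCoef (Sum.inr s)

/-- `P̂(S = s, C)`. -/
noncomputable def probSCHat (s : 𝒮) : ℝ := x.nS s / n * (x.r1 s - x.r0 s)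

/-- `P̂(C)`. -/
noncomputable def probCHat : ℝ := ∑ s, x.nS s / n * (x.r1 s - x.r0 s)

/-- `β̂ = ∑ₛ P̂(S = s | C) β̂(s)` with `P̂(S = s | C) = P̂(S = s, C) / P̂(C)`. -/
noncomputable def betaHat : ℝ := ∑ s, x.probSCHat s / x.probCHat * x.betaHatAt s

/-- The IV residuals `ûᵢ`. -/
noncomputable def resid (i : Fin n) : ℝ :=
  x.Y i - ∑ s, (if x.S i = s then 1 else 0) * x.gammaHatAt s
    - ∑ s, (if x.D i = true then 1 else 0) * (if x.S i = s then 1 else 0) * x.betaHatAt s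

/-- `(1/n) ∑ᵢ I{Dᵢ = d, Aᵢ = a, Sᵢ = s} (ûᵢ + c)²`. -/
noncomputable def cellMeanSq (d a : Bool) (s : 𝒮) (c : ℝ) : ℝ :=
  1 / n * ∑ i, (if x.D i = d ∧ x.A i = a ∧ x.S i = s then 1 else 0) * (x.resid i + c) ^ 2

/-- `V̂₁`. -/
noncomputable def V1Hat : ℝ :=
  1 / x.probCHat ^ 2 * ∑ s, (x.nS s / x.nA s) ^ 2 *
    (x.cellMeanSq true true s ((1 - x.r1 s) * (x.betaHatAt s - x.betaHat))
      + x.cellMeanSq false true s (-(x.r1 s * (x.betaHatAt s - x.betaHat))))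

/-- `V̂₀`. -/
noncomputable def V0Hat : ℝ :=
  1 / x.probCHat ^ 2 * ∑ s, (x.nS s / (x.nS s - x.nA s)) ^ 2 *
    (x.cellMeanSq true false s ((1 - x.r0 s) * (x.betaHatAt s - x.betaHat))
      + x.cellMeanSq false false s (-(x.r0 s * (x.betaHatAt s - x.betaHat))))

/-- `V̂_H`. -/
noncomputable def VHHat : ℝ :=
  1 / x.probCHat ^ 2 * ∑ s, x.nS s / n * (x.r1 s - x.r0 s) ^ 2
    * (x.betaHatAt s - x.betaHat) ^ 2

/-- The plug-in estimator `V̂_sat = V̂₁ + V̂₀ + V̂_H`. -/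
noncomputable def VsatHat : ℝ := x.V1Hat + x.V0Hat + x.VHHat

end Sample

/-- Convergence in probability to a constant; the `n`-th variable may live on its own
probability space. -/
def TendstoInProb {Ω : ℕ → Type*} [∀ n, MeasurableSpace (Ω n)] (μ : ∀ n, Measure (Ω n))
    (X : ∀ n, Ω n → ℝ) (c : ℝ) : Prop :=
  ∀ ε : ℝ, 0 < ε → Tendsto (fun n => μ n {ω | ε ≤ |X n ω - c|}) atTop (𝓝 0)

/-- Assumptions on the data generating process: for every `n`, the underlying variables of the `n`
participants are i.i.d. with common law `Q`, and `Q` has square integrable potential outcomes,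
strata of positive probability, no defiers, and compliers in every stratum. -/
structure DataAssumption {𝒵 𝒮 : Type*} [MeasurableSpace 𝒵]
    {Ω : ℕ → Type*} [∀ n, MeasurableSpace (Ω n)] (μ : ∀ n, Measure (Ω n))
    (Q : Measure (Participant 𝒵)) (S : 𝒵 → 𝒮)
    (W : ∀ n, Ω n → Fin n → Participant 𝒵) : Prop where
  measurable_W : ∀ n, Measurable (W n)
  indep : ∀ n, iIndepFun (fun (i : Fin n) ω => W n ω i) (μ n)
  law : ∀ n (i : Fin n), (μ n).map (fun ω => W n ω i) = Q
  sq_integrable : ∀ d, Integrable (fun w => potY d w ^ 2) Q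
  p_pos : ∀ s, 0 < p Q S s
  no_defiers : Q (defiers 𝒵) = 0
  compliers_pos : ∀ s, 0 < piD Q S true s - piD Q S false s

/-- Assumptions on the treatment assignment mechanism. The conditional independence
`W⁽ⁿ⁾ ⊥ A⁽ⁿ⁾ | S⁽ⁿ⁾` is stated given each value of the vector `S⁽ⁿ⁾`, which takes finitely many
values (conditioning on an event of probability zero gives the zero measure, under which
independence is no condition). -/
structure AssignmentAssumption {𝒵 𝒮 : Type*} [MeasurableSpace 𝒵] [DecidableEq 𝒮]
    {Ω : ℕ → Type*} [∀ n, MeasurableSpace (Ω n)] (μ : ∀ n, Measure (Ω n)) (S : 𝒵 → 𝒮)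
    (W : ∀ n, Ω n → Fin n → Participant 𝒵) (A : ∀ n, Ω n → Fin n → Bool)
    (πA : 𝒮 → ℝ) : Prop where
  measurable_A : ∀ n, Measurable (A n)
  condIndep : ∀ n (s : Fin n → 𝒮),
    IndepFun (W n) (A n) (ProbabilityTheory.cond (μ n) {ω | ∀ i, stratum S (W n ω i) = s i})
  target_mem : ∀ s, πA s ∈ Set.Ioo (0 : ℝ) 1
  share_tendsto : ∀ s, TendstoInProb μ
    (fun n ω => (observe S (W n ω) (A n ω)).nA s / (observe S (W n ω) (A n ω)).nS s) (πA s)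

end SatIV

/-! Write π_a for π_{D(a)}(s) and m_a for E[Y(D(a)) | S = s]. The saturated IV fit is, stratum by
stratum, a Wald ratio with an intercept (`Sample.ivCoef_eq`), so in the limit γ(s) + π_a β(s) = m_a
in both arms. Adding (1 - r_a) δ̂(s) to the residual of a treated participant, or -r_a δ̂(s) to that
of an untreated one, therefore replaces β(s) by β and recentres: the shifted residual estimates Y -
βD - (m_a - π_a β). Consequently P(C)² V̂₁ tends to ∑ₛ p(s)/π_A(s) · V[Y(D(1)) - β D(1) | S = s],
and P(C)² V̂₀ to its control analogue with 1 - π_A(s). The law of total variance, over D(a) and then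
over compliers, always takers and never takers, splits these into V_{Y,a} and V_{D,a}; V̂_H is a
direct plug-in.

All of this is continuous in finitely many averages of Y^k, k ≤ 2, over the cells {D = d, A = a, S =
s} (`Sample.cellMeanSq_eq`), so what is needed is a law of large numbers for these averages,
`tendstoInProb_mean`. The assignments may depend on each other arbitrarily, so the summands are not
independent. But a function of W that is centred within every stratum, multiplied by an assignment
indicator, gives pairwise orthogonal summands: given the strata, W is independent of A and
participants are independent of each other. Chebyshev then handles bounded functions, and L¹
approximation the rest. The remaining factor, the share of the arm in the sample, converges by
assumption.

The limits of the cell averages are expressed through participant types by `cellMean_true_true` and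
its three companions, where the absence of defiers enters. Probability-weighted moments are used
throughout, so that empty types need no separate treatment. -/

namespace SatIV

/-! ### Convergence in probability as convergence along a filter, and moment inequalities. -/

section InProb

variable {Ω : ℕ → Type*} [∀ n, MeasurableSpace (Ω n)] (μ : ∀ n, Measure (Ω n))

/-- The filter of sets whose `n`-th slice has `μ n`-probability tending to one: convergence in
probability is convergence along this filter. -/
def inProb : Filter (Σ n, Ω n) where
  sets := {T | Tendsto (fun n => μ n {ω | (⟨n, ω⟩ : Σ n, Ω n) ∉ T}) atTop (𝓝 0)}
  univ_sets := by simp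
  sets_of_superset := by
    intro T T' hT hTT'
    refine tendsto_of_tendsto_of_tendsto_of_le_of_le tendsto_const_nhds hT
      (fun _ => zero_le) fun n => measure_mono fun ω hω h => hω (hTT' h)
  inter_sets := by
    intro T T' hT hT'
    have h := hT.add hT'
    rw [add_zero] at h
    refine tendsto_of_tendsto_of_tendsto_of_le_of_le tendsto_const_nhds h
      (fun _ => zero_le) fun n => (measure_mono ?_).trans (measure_union_le _ _)
    intro ω hω
    by_contra hc
    simp only [Set.mem_union, Set.mem_ofPred_eq, not_or, not_not] at hc
    exact hω hc

variable {μ}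

theorem eventually_inProb {P : (Σ n, Ω n) → Prop} :
    (∀ᶠ x in inProb μ, P x) ↔ Tendsto (fun n => μ n {ω | ¬ P ⟨n, ω⟩}) atTop (𝓝 0) := Iff.rfl

/-- This turns the continuous mapping theorem and Slutsky-type arguments into the ordinary algebra
of limits, although the sample spaces vary with `n`. -/
theorem tendstoInProb_iff {X : ∀ n, Ω n → ℝ} {c : ℝ} :
    TendstoInProb μ X c ↔ Tendsto (fun x : Σ n, Ω n => X x.1 x.2) (inProb μ) (𝓝 c) := by
  simp only [Metric.tendsto_nhds, eventually_inProb, Real.dist_eq, not_lt]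
  rfl

theorem eventually_inProb_of_eventually {P : ℕ → Prop} (h : ∀ᶠ n in atTop, P n) :
    ∀ᶠ x in inProb μ, P x.1 := by
  rw [eventually_inProb]
  refine tendsto_const_nhds.congr' ?_
  filter_upwards [h] with n hn
  simp [hn]

/-- Markov's inequality for the first absolute moment. -/
theorem measure_le_abs_le {α : Type*} [MeasurableSpace α] {ν : Measure α} [IsFiniteMeasure ν]
    {X : α → ℝ} (hX : Integrable X ν) {ε b : ℝ} (hε : 0 < ε) (hb : ∫ ω, |X ω| ∂ν ≤ b) :
    ν {ω | ε ≤ |X ω|} ≤ ENNReal.ofReal (b / ε) := by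
  have h := mul_meas_ge_le_integral_of_nonneg (μ := ν) (f := fun ω => |X ω|)
    (Eventually.of_forall fun ω => abs_nonneg _) hX.abs ε
  rw [← ofReal_measureReal]
  refine ENNReal.ofReal_le_ofReal ?_
  rw [le_div_iff₀ hε]
  linarith

/-- Chebyshev's inequality about zero. -/
theorem measure_le_abs_le_sq {α : Type*} [MeasurableSpace α] {ν : Measure α} [IsFiniteMeasure ν]
    {X : α → ℝ} (hX : Integrable (fun ω => X ω ^ 2) ν) {ε b : ℝ} (hε : 0 < ε)
    (hb : ∫ ω, X ω ^ 2 ∂ν ≤ b) :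
    ν {ω | ε ≤ |X ω|} ≤ ENNReal.ofReal (b / ε ^ 2) := by
  have h := measure_le_abs_le hX (pow_pos hε 2) (b := b) (by simpa using hb)
  refine (measure_mono fun ω hω => ?_).trans h
  simp only [Set.mem_ofPred_eq, abs_pow] at hω ⊢
  gcongr

/-- The mean of bounded pairwise orthogonal variables has second moment at most `K ^ 2 / n`. -/
theorem integral_sq_mean_le {α : Type*} [MeasurableSpace α] {ν : Measure α}
    [IsProbabilityMeasure ν] {n : ℕ} {X : Fin n → α → ℝ} {K : ℝ}
    (hm : ∀ i, AEStronglyMeasurable (X i) ν) (hK : ∀ i ω, |X i ω| ≤ K)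
    (horth : ∀ i j, i ≠ j → ∫ ω, X i ω * X j ω ∂ν = 0) :
    Integrable (fun ω => (1 / (n : ℝ) * ∑ i, X i ω) ^ 2) ν ∧
      ∫ ω, (1 / (n : ℝ) * ∑ i, X i ω) ^ 2 ∂ν ≤ K ^ 2 * (1 / n) := by
  have hint : ∀ i j, Integrable (fun ω => X i ω * X j ω) ν := fun i j =>
    Integrable.of_bound ((hm i).mul (hm j)) (K * K) (Eventually.of_forall fun ω => by
      have h1 := hK i ω
      have h2 := hK j ω
      rw [Real.norm_eq_abs, abs_mul]
      gcongr
      exact (abs_nonneg _).trans h1)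
  have hexp : (fun ω => (1 / (n : ℝ) * ∑ i, X i ω) ^ 2)
      = fun ω => (1 / (n : ℝ)) ^ 2 * ∑ i, ∑ j, X i ω * X j ω := by
    funext ω
    rw [mul_pow, sq (∑ i, X i ω), Finset.sum_mul_sum]
  have hint' : ∀ i, Integrable (fun ω => ∑ j, X i ω * X j ω) ν := fun i =>
    integrable_finsetSum _ fun j _ => hint i j
  rw [hexp]
  refine ⟨(integrable_finsetSum _ fun i _ => hint' i).const_mul _, ?_⟩
  rw [integral_const_mul, integral_finsetSum _ fun i _ => hint' i]
  have hdiag : ∀ i, ∫ ω, ∑ j, X i ω * X j ω ∂ν ≤ K ^ 2 := by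
    intro i
    rw [integral_finsetSum _ fun j _ => hint i j,
      Finset.sum_eq_single i (fun j _ hj => horth i j hj.symm) (by simp)]
    refine (integral_mono (hint i i) (integrable_const (K ^ 2)) fun ω => ?_).trans (by simp)
    have := hK i ω
    simp only [← sq]
    rw [← sq_abs]
    gcongr
  calc (1 / (n : ℝ)) ^ 2 * ∑ i, ∫ ω, ∑ j, X i ω * X j ω ∂ν
      ≤ (1 / (n : ℝ)) ^ 2 * ∑ _i : Fin n, K ^ 2 := by gcongr with i; exact hdiag i
    _ = K ^ 2 * (1 / n) := by
      rcases Nat.eq_zero_or_pos n with rfl | hn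
      · simp
      · simp only [Finset.sum_const, Finset.card_univ, Fintype.card_fin, nsmul_eq_mul]
        field_simp

/-- A weak law for triangular arrays: orthogonality alone makes the second moment of the mean
O(1/n), and Chebyshev concludes. Independence of the summands is not available in the application.
-/
theorem tendstoInProb_mean_of_orthogonal [∀ n, IsProbabilityMeasure (μ n)]
    {X : ∀ n, Fin n → Ω n → ℝ} {K : ℝ}
    (hm : ∀ n i, AEStronglyMeasurable (X n i) (μ n)) (hK : ∀ n i ω, |X n i ω| ≤ K)
    (horth : ∀ n i j, i ≠ j → ∫ ω, X n i ω * X n j ω ∂(μ n) = 0) :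
    TendstoInProb μ (fun n ω => 1 / (n : ℝ) * ∑ i, X n i ω) 0 := by
  intro ε hε
  have hlim : Tendsto (fun n : ℕ => ENNReal.ofReal (K ^ 2 * (1 / (n : ℝ)) / ε ^ 2)) atTop (𝓝 0) := by
    have h := ((tendsto_one_div_atTop_nhds_zero_nat (𝕜 := ℝ)).const_mul (K ^ 2)).div_const (ε ^ 2)
    simpa using ENNReal.tendsto_ofReal h
  refine tendsto_of_tendsto_of_tendsto_of_le_of_le tendsto_const_nhds hlim
    (fun _ => zero_le) fun n => ?_
  obtain ⟨h1, h2⟩ := integral_sq_mean_le (hm n) (hK n) (horth n)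
  simpa using measure_le_abs_le_sq h1 hε h2

end InProb

/-! ### Measurability of the coordinates of a participant. -/

section Measurability

variable {𝒵 𝒮 : Type*} [MeasurableSpace 𝒵]

theorem measurable_potY (d : Bool) : Measurable (potY (𝒵 := 𝒵) d) :=
  (measurable_pi_apply d).comp measurable_fst

theorem measurable_potD (a : Bool) : Measurable (potD (𝒵 := 𝒵) a) :=
  (measurable_pi_apply a).comp (measurable_fst.comp measurable_snd)

theorem measurable_stratum [MeasurableSpace 𝒮] {S : 𝒵 → 𝒮} (hS : Measurable S) :
    Measurable (stratum S) :=
  hS.comp (measurable_snd.comp measurable_snd)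

theorem measurableSet_inStratum [MeasurableSpace 𝒮] [MeasurableSingletonClass 𝒮] {S : 𝒵 → 𝒮}
    (hS : Measurable S) (s : 𝒮) : MeasurableSet (inStratum S s) :=
  measurable_stratum hS (measurableSet_singleton s)

theorem measurableSet_potD (a d : Bool) : MeasurableSet {w : Participant 𝒵 | potD a w = d} :=
  measurable_potD a (measurableSet_singleton d)

end Measurability

/-! ### Uncorrelatedness of centred functions of distinct participants. -/

section Orthogonality

variable {𝒵 𝒮 : Type*} [MeasurableSpace 𝒵] [Fintype 𝒮] [DecidableEq 𝒮] [MeasurableSpace 𝒮]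
  [MeasurableSingletonClass 𝒮] {S : 𝒵 → 𝒮} {Q : Measure (Participant 𝒵)}
  {α : Type*} [MeasurableSpace α] {ν : Measure α} {n : ℕ} {W : α → Fin n → Participant 𝒵}

/-- Fixing the whole stratum vector is a product event, so independence survives: the integral
factors over participants, and the factor of `i` is a within-stratum mean of `h`. -/
theorem setIntegral_strata_mul_eq_zero (hS : Measurable S) (hW : Measurable W)
    (hind : iIndepFun (fun (i : Fin n) ω => W ω i) ν)
    (hlaw : ∀ i, ν.map (fun ω => W ω i) = Q) {h : Participant 𝒵 → ℝ} (hh : Measurable h)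
    (h0 : ∀ s, ∫ w in inStratum S s, h w ∂Q = 0) {i j : Fin n} (hij : i ≠ j) (σ : Fin n → 𝒮) :
    ∫ ω in {ω | ∀ k, stratum S (W ω k) = σ k}, h (W ω i) * h (W ω j) ∂ν = 0 := by
  have hWk : ∀ k, Measurable fun ω => W ω k := fun k => (measurable_pi_apply k).comp hW
  have hE : MeasurableSet {ω | ∀ k, stratum S (W ω k) = σ k} := by
    have : {ω | ∀ k, stratum S (W ω k) = σ k} = ⋂ k, (fun ω => W ω k) ⁻¹' inStratum S (σ k) := by
      ext ω; simp [inStratum]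
    rw [this]
    exact MeasurableSet.iInter fun k => hWk k (measurableSet_inStratum hS _)
  -- One factor per participant: the indicators multiply to that of the stratum event, and the last
  -- two factors insert `h` once at `i` and once at `j`.
  let φ : Fin n → Participant 𝒵 → ℝ := fun k w =>
    (if stratum S w = σ k then 1 else 0) * ((if k = i then h w else 1) * (if k = j then h w else 1))
  have hφ : ∀ k, Measurable (φ k) := by
    intro k
    have h1 : Measurable fun w : Participant 𝒵 => if stratum S w = σ k then (1 : ℝ) else 0 :=
      Measurable.ite (measurableSet_inStratum hS (σ k)) measurable_const measurable_const
    have h2 : ∀ l, Measurable fun w : Participant 𝒵 => if k = l then h w else 1 := by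
      intro l
      split_ifs
      exacts [hh, measurable_const]
    exact h1.mul ((h2 i).mul (h2 j))
  have hprod : ∀ ω, ({ω | ∀ k, stratum S (W ω k) = σ k}.indicator
      (fun ω => h (W ω i) * h (W ω j)) ω) = ∏ k, φ k (W ω k) := by
    intro ω
    simp only [φ, Finset.prod_mul_distrib, Finset.prod_ite_eq', Finset.mem_univ, if_true]
    by_cases hω : ∀ k, stratum S (W ω k) = σ k
    · rw [Set.indicator_of_mem (by exact hω), Finset.prod_eq_one (fun k _ => if_pos (hω k)),
        one_mul]
    · rw [Set.indicator_of_notMem (by exact hω)]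
      push Not at hω
      obtain ⟨k, hk⟩ := hω
      rw [Finset.prod_eq_zero (Finset.mem_univ k) (if_neg hk), zero_mul]
  rw [← integral_indicator hE, integral_congr_ae (Eventually.of_forall hprod),
    hind.integral_fun_prod_comp (fun k => (hWk k).aemeasurable)
      (fun k => (hφ k).aestronglyMeasurable)]
  refine Finset.prod_eq_zero (Finset.mem_univ i) ?_
  rw [← integral_map (f := φ i) (hWk i).aemeasurable (hφ i).aestronglyMeasurable, hlaw i]
  have : φ i = (inStratum S (σ i)).indicator h := by
    funext w
    by_cases hw : stratum S w = σ i
    · rw [Set.indicator_of_mem (by exact hw)]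
      simp [φ, hw, hij]
    · rw [Set.indicator_of_notMem (by exact hw)]
      simp [φ, hw]
  rw [this, integral_indicator (measurableSet_inStratum hS _), h0]

/-- Given the stratum vector, `W` and `A` are independent, so the conditional expectation splits and
its `W` factor vanishes by the previous lemma. No restriction on the joint law of the assignments is
involved, since `F` is arbitrary. -/
theorem integral_assignment_mul_eq_zero [IsProbabilityMeasure ν] (hS : Measurable S)
    (hW : Measurable W)
    (hind : iIndepFun (fun (i : Fin n) ω => W ω i) ν)
    (hlaw : ∀ i, ν.map (fun ω => W ω i) = Q) {A : α → Fin n → Bool} (hA : Measurable A)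
    (hWA : ∀ σ : Fin n → 𝒮,
      IndepFun W A (ProbabilityTheory.cond ν {ω | ∀ i, stratum S (W ω i) = σ i}))
    (F : (Fin n → Bool) → ℝ) {h : Participant 𝒵 → ℝ} (hh : Measurable h) {K : ℝ}
    (hK : ∀ w, |h w| ≤ K)
    (h0 : ∀ s, ∫ w in inStratum S s, h w ∂Q = 0) {i j : Fin n} (hij : i ≠ j) :
    ∫ ω, (h (W ω i) * h (W ω j)) * F (A ω) ∂ν = 0 := by
  have hWk : ∀ k, Measurable fun ω => W ω k := fun k => (measurable_pi_apply k).comp hW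
  set E : (Fin n → 𝒮) → Set α := fun σ => {ω | ∀ k, stratum S (W ω k) = σ k} with hEdef
  have hE : ∀ σ, MeasurableSet (E σ) := by
    intro σ
    have : E σ = ⋂ k, (fun ω => W ω k) ⁻¹' inStratum S (σ k) := by
      ext ω; simp [E, inStratum]
    rw [this]
    exact MeasurableSet.iInter fun k => hWk k (measurableSet_inStratum hS _)
  have hF : Measurable F := measurable_of_finite F
  have hG : Measurable fun w : Fin n → Participant 𝒵 => h (w i) * h (w j) :=
    (hh.comp (measurable_pi_apply i)).mul (hh.comp (measurable_pi_apply j))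
  obtain ⟨B, hB⟩ : ∃ B, ∀ b, |F b| ≤ B := by
    obtain ⟨B, hB⟩ := (Set.finite_range fun b => |F b|).bddAbove
    exact ⟨B, fun b => hB ⟨b, rfl⟩⟩
  have hint : Integrable (fun ω => (h (W ω i) * h (W ω j)) * F (A ω)) ν := by
    refine Integrable.of_bound ((hG.comp hW).mul (hF.comp hA)).aestronglyMeasurable
      (K * K * B) (Eventually.of_forall fun ω => ?_)
    have h1 := hK (W ω i)
    have h2 := hK (W ω j)
    have h3 := hB (A ω)
    have hK0 : 0 ≤ K := (abs_nonneg _).trans h1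
    rw [Real.norm_eq_abs, abs_mul, abs_mul]
    gcongr
  have hU : (⋃ σ, E σ) = Set.univ := by
    ext ω
    simp only [Set.mem_iUnion, Set.mem_univ, iff_true]
    exact ⟨fun k => stratum S (W ω k), fun k => rfl⟩
  have hdisj : Pairwise (Function.onFun Disjoint E) := by
    intro σ τ hστ
    refine Set.disjoint_left.2 fun ω hω hω' => hστ ?_
    funext k
    exact (hω k).symm.trans (hω' k)
  rw [← setIntegral_univ, ← hU, integral_iUnion_fintype hE hdisj fun σ => hint.integrableOn]
  refine Finset.sum_eq_zero fun σ _ => ?_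
  -- On a null stratum vector the conditional measure is zero and carries no information, but the
  -- integral vanishes anyway.
  by_cases hσ : ν (E σ) = 0
  · exact setIntegral_measure_zero _ hσ
  have hc : ((ν (E σ))⁻¹).toReal ≠ 0 := by
    rw [ENNReal.toReal_ne_zero]
    exact ⟨ENNReal.inv_ne_zero.2 (measure_ne_top _ _), ENNReal.inv_ne_top.2 hσ⟩
  have hcond : ∀ f : α → ℝ, ∫ ω, f ω ∂(ProbabilityTheory.cond ν (E σ))
      = ((ν (E σ))⁻¹).toReal * ∫ ω in E σ, f ω ∂ν := by
    intro f
    rw [ProbabilityTheory.cond, integral_smul_measure, smul_eq_mul]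
  have hmul := ((hWA σ).comp hG hF).integral_fun_mul_eq_mul_integral
    (hG.comp hW).aestronglyMeasurable (hF.comp hA).aestronglyMeasurable
  have hz : ∫ ω, h (W ω i) * h (W ω j) ∂(ProbabilityTheory.cond ν (E σ)) = 0 := by
    rw [hcond, setIntegral_strata_mul_eq_zero hS hW hind hlaw hh h0 hij σ, mul_zero]
  simp only [Function.comp_apply] at hmul
  rw [hz, zero_mul] at hmul
  rw [hcond] at hmul
  exact (mul_eq_zero.1 hmul).resolve_left hc

/-- Centred functions of distinct participants are uncorrelated. -/
theorem integral_mul_eq_zero_of_iid [IsProbabilityMeasure ν] (hW : Measurable W)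
    (hind : iIndepFun (fun (i : Fin n) ω => W ω i) ν)
    (hlaw : ∀ i, ν.map (fun ω => W ω i) = Q) {h : Participant 𝒵 → ℝ} (hh : Measurable h)
    (h0 : ∫ w, h w ∂Q = 0) {i j : Fin n} (hij : i ≠ j) :
    ∫ ω, h (W ω i) * h (W ω j) ∂ν = 0 := by
  have hWk : ∀ k, Measurable fun ω => W ω k := fun k => (measurable_pi_apply k).comp hW
  have hz : ∫ ω, h (W ω i) ∂ν = 0 := by
    rw [← integral_map (f := h) (hWk i).aemeasurable hh.aestronglyMeasurable, hlaw i, h0]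
  have := ((hind.indepFun hij).comp hh hh).integral_fun_mul_eq_mul_integral
    (hh.comp (hWk i)).aestronglyMeasurable (hh.comp (hWk j)).aestronglyMeasurable
  simp only [Function.comp_apply] at this
  rw [this, hz, zero_mul]

end Orthogonality

/-- The limiting share `π_A(s)` or `1 - π_A(s)` of stratum `s` assigned to `a`. -/
noncomputable def assignProb {𝒮 : Type*} (πA : 𝒮 → ℝ) (a : Bool) (s : 𝒮) : ℝ :=
  if a = true then πA s else 1 - πA s

/-! ### The law of large numbers within a stratum and an assignment arm. -/

section LawOfLargeNumbers

variable {𝒵 𝒮 : Type*} [MeasurableSpace 𝒵]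
  [Fintype 𝒮] [DecidableEq 𝒮] [MeasurableSpace 𝒮] [MeasurableSingletonClass 𝒮]
  {S : 𝒵 → 𝒮} {Q : Measure (Participant 𝒵)}
  {Ω : ℕ → Type*} [∀ n, MeasurableSpace (Ω n)]
  {μ : ∀ n, Measure (Ω n)}
  {W : ∀ n, Ω n → Fin n → Participant 𝒵} {A : ∀ n, Ω n → Fin n → Bool} {πA : 𝒮 → ℝ}

theorem assignProb_pos (hA : AssignmentAssumption μ S W A πA) (a : Bool) (s : 𝒮) :
    0 < assignProb πA a s := by
  have := hA.target_mem s
  cases a <;> simp [assignProb, this.1, this.2]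

variable [IsProbabilityMeasure Q] [∀ n, IsProbabilityMeasure (μ n)]

theorem tendstoInProb_stratum_share (hS : Measurable S) (hW : DataAssumption μ Q S W) (s : 𝒮) :
    TendstoInProb μ
      (fun n ω => 1 / (n : ℝ) * ∑ i, if stratum S (W n ω i) = s then 1 else 0) (p Q S s) := by
  set h : Participant 𝒵 → ℝ := fun w => (if stratum S w = s then 1 else 0) - p Q S s with hdef
  have hE := measurableSet_inStratum hS s
  have h1 : Measurable fun w : Participant 𝒵 => if stratum S w = s then (1 : ℝ) else 0 :=
    Measurable.ite hE measurable_const measurable_const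
  have hh : Measurable h := h1.sub_const _
  have hp0 : 0 ≤ p Q S s := measureReal_nonneg
  have hp1 : p Q S s ≤ 1 := measureReal_le_one
  have hK : ∀ w, |h w| ≤ 1 := by
    intro w
    rw [abs_le]
    simp only [hdef]
    split_ifs <;> constructor <;> linarith
  have h0 : ∫ w, h w ∂Q = 0 := by
    have hi : (fun w : Participant 𝒵 => if stratum S w = s then (1 : ℝ) else 0)
        = (inStratum S s).indicator 1 := by
      funext w
      by_cases hw : stratum S w = s <;> simp [Set.indicator, inStratum, hw]
    have hint : Integrable (fun w : Participant 𝒵 => if stratum S w = s then (1 : ℝ) else 0) Q := by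
      rw [hi]
      exact (integrable_const (1 : ℝ)).indicator hE
    rw [integral_sub hint (integrable_const _), hi, integral_indicator_one hE]
    simp [p]
  have hWk : ∀ n k, Measurable fun ω => W n ω k := fun n k =>
    (measurable_pi_apply k).comp (hW.measurable_W n)
  have key := tendstoInProb_mean_of_orthogonal (μ := μ) (X := fun n i ω => h (W n ω i)) (K := 1)
    (fun n i => (hh.comp (hWk n i)).aestronglyMeasurable) (fun n i ω => hK _)
    (fun n i j hij => integral_mul_eq_zero_of_iid (hW.measurable_W n) (hW.indep n) (hW.law n)
      hh h0 hij)
  rw [tendstoInProb_iff] at key ⊢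
  have := key.add_const (p Q S s)
  rw [zero_add] at this
  refine this.congr' ?_
  filter_upwards [eventually_inProb_of_eventually (eventually_ne_atTop 0)] with x hx
  have hn : (x.1 : ℝ) ≠ 0 := by exact_mod_cast hx
  simp only [hdef, Finset.sum_sub_distrib, Finset.sum_const, Finset.card_univ, Fintype.card_fin,
    nsmul_eq_mul]
  field_simp
  ring

/-- The treated share is n_A(s)/n(s) times n(s)/n, and the control share is the complement within
the stratum. -/
theorem tendstoInProb_assignment_share (hS : Measurable S) (hW : DataAssumption μ Q S W)
    (hA : AssignmentAssumption μ S W A πA) (a : Bool) (s : 𝒮) :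
    TendstoInProb μ
      (fun n ω => 1 / (n : ℝ) * ∑ i, if A n ω i = a ∧ stratum S (W n ω i) = s then 1 else 0)
      (assignProb πA a s * p Q S s) := by
  have hs := tendstoInProb_stratum_share hS hW s
  have hr := hA.share_tendsto s
  rw [tendstoInProb_iff] at hs hr ⊢
  -- In an empty stratum the ratio n_A(s)/n(s) is 0 by default; the factorization still holds
  -- because n_A(s) is 0 as well.
  have hle : ∀ (n : ℕ) (ω : Ω n), (observe S (W n ω) (A n ω)).nS s = 0 →
      (observe S (W n ω) (A n ω)).nA s = 0 := by
    intro n ω h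
    rw [Sample.nS, Finset.sum_eq_zero_iff_of_nonneg (fun i _ => by split_ifs <;> norm_num)] at h
    refine Finset.sum_eq_zero fun i hi => ?_
    have := h i hi
    split_ifs at this ⊢ with h1 h2
    all_goals first | rfl | simp_all
  have htrue : ∀ (n : ℕ) (ω : Ω n),
      1 / (n : ℝ) * ∑ i, (if A n ω i = true ∧ stratum S (W n ω i) = s then (1 : ℝ) else 0)
        = (observe S (W n ω) (A n ω)).nA s / (observe S (W n ω) (A n ω)).nS s
          * (1 / (n : ℝ) * ∑ i, if stratum S (W n ω i) = s then 1 else 0) := by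
    intro n ω
    change 1 / (n : ℝ) * (observe S (W n ω) (A n ω)).nA s
      = _ * (1 / (n : ℝ) * (observe S (W n ω) (A n ω)).nS s)
    by_cases h : (observe S (W n ω) (A n ω)).nS s = 0
    · rw [hle n ω h]; simp
    · field_simp
  cases a with
  | true => exact (hr.mul hs).congr fun x => (htrue x.1 x.2).symm
  | false =>
    have := hs.sub (hr.mul hs)
    have hlim : p Q S s - πA s * p Q S s = assignProb πA false s * p Q S s := by
      simp [assignProb]; ring
    rw [hlim] at this
    refine this.congr fun x => ?_
    rw [← htrue x.1 x.2, ← mul_sub, ← Finset.sum_sub_distrib]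
    congr 1
    refine Finset.sum_congr rfl fun i _ => ?_
    cases A x.1 x.2 i <;> simp

/-- Split `f` on the stratum into its conditional mean `c` and a centred remainder. The remainder
averages to zero by orthogonality, and `c` multiplies the assignment share. -/
theorem tendstoInProb_mean_of_bounded (hS : Measurable S) (hW : DataAssumption μ Q S W)
    (hA : AssignmentAssumption μ S W A πA) (a : Bool) (s : 𝒮) {f : Participant 𝒵 → ℝ}
    (hf : Measurable f) {K : ℝ} (hK : ∀ w, |f w| ≤ K) :
    TendstoInProb μ
      (fun n ω => 1 / (n : ℝ) *
        ∑ i, if A n ω i = a ∧ stratum S (W n ω i) = s then f (W n ω i) else 0)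
      (assignProb πA a s * ∫ w in inStratum S s, f w ∂Q) := by
  have hE := measurableSet_inStratum hS s
  have hp : p Q S s ≠ 0 := (hW.p_pos s).ne'
  have hfint : Integrable f Q := Integrable.of_bound hf.aestronglyMeasurable K
    (Eventually.of_forall hK)
  set c : ℝ := (∫ w in inStratum S s, f w ∂Q) / p Q S s with hc
  -- The indicator makes `h` centred in every stratum, not only in `s`, as the orthogonality lemma
  -- requires.
  set h : Participant 𝒵 → ℝ := (inStratum S s).indicator fun w => f w - c with hdef
  have hh : Measurable h := (hf.sub_const c).indicator hE
  have hhK : ∀ w, |h w| ≤ K + |c| := by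
    intro w
    have h1 := hK w
    by_cases hw : w ∈ inStratum S s
    · rw [hdef, Set.indicator_of_mem hw]
      exact (abs_sub _ _).trans (by gcongr)
    · rw [hdef, Set.indicator_of_notMem hw, abs_zero]
      have := abs_nonneg (f w)
      positivity [abs_nonneg c, this.trans h1]
  have h0 : ∀ s', ∫ w in inStratum S s', h w ∂Q = 0 := by
    intro s'
    rw [hdef, setIntegral_indicator hE]
    by_cases hs' : s' = s
    · subst hs'
      rw [Set.inter_self, integral_sub hfint.integrableOn (integrable_const _)]
      simp only [integral_const, measureReal_restrict_apply_univ, smul_eq_mul]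
      change _ - p Q S s' * c = 0
      rw [hc]
      field_simp
      ring
    · have : inStratum S s' ∩ inStratum S s = ∅ := by
        ext w
        simp only [inStratum, Set.mem_inter_iff, Set.mem_ofPred_eq, Set.mem_empty_iff_false,
          iff_false, not_and]
        intro h1 h2
        exact hs' (h1.symm.trans h2)
      rw [this, setIntegral_empty]
  have hWk : ∀ n k, Measurable fun ω => W n ω k := fun n k =>
    (measurable_pi_apply k).comp (hW.measurable_W n)
  have hAk : ∀ n k, Measurable fun ω => A n ω k := fun n k =>
    (measurable_pi_apply k).comp (hA.measurable_A n)
  have hI : ∀ n k, Measurable fun ω => if A n ω k = a then (1 : ℝ) else 0 := fun n k =>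
    Measurable.ite (hAk n k (measurableSet_singleton a)) measurable_const measurable_const
  have key := tendstoInProb_mean_of_orthogonal (μ := μ)
    (X := fun n i ω => (if A n ω i = a then (1 : ℝ) else 0) * h (W n ω i)) (K := K + |c|)
    (fun n i => ((hI n i).mul (hh.comp (hWk n i))).aestronglyMeasurable)
    (fun n i ω => by
      have := hhK (W n ω i)
      split_ifs
      · simpa using this
      · simpa using (abs_nonneg _).trans this)
    (fun n i j hij => by
      have := integral_assignment_mul_eq_zero hS (hW.measurable_W n) (hW.indep n) (hW.law n)
        (hA.measurable_A n) (hA.condIndep n)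
        (fun b => (if b i = a then (1 : ℝ) else 0) * (if b j = a then (1 : ℝ) else 0))
        hh hhK h0 hij
      refine Eq.trans ?_ this
      congr 1
      funext ω
      ring)
  have hshare := tendstoInProb_assignment_share hS hW hA a s
  rw [tendstoInProb_iff] at key hshare ⊢
  have hsum := key.add (hshare.const_mul c)
  have hlim : 0 + c * (assignProb πA a s * p Q S s)
      = assignProb πA a s * ∫ w in inStratum S s, f w ∂Q := by
    rw [hc]; field_simp; ring
  rw [hlim] at hsum
  refine hsum.congr fun x => ?_
  rw [mul_left_comm, ← mul_add, Finset.mul_sum, ← Finset.sum_add_distrib]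
  congr 1
  refine Finset.sum_congr rfl fun i _ => ?_
  by_cases h1 : A x.1 x.2 i = a <;> by_cases h2 : stratum S (W x.1 x.2 i) = s
  · rw [hdef, Set.indicator_of_mem (by exact h2)]
    simp [h1, h2]
  · rw [hdef, Set.indicator_of_notMem (by exact h2)]
    simp [h1, h2]
  · simp [h1]
  · simp [h1]

/-- The law of large numbers within a stratum and an assignment arm. -/
theorem tendstoInProb_mean (hS : Measurable S) (hW : DataAssumption μ Q S W)
    (hA : AssignmentAssumption μ S W A πA) (a : Bool) (s : 𝒮) {f : Participant 𝒵 → ℝ}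
    (hf : Measurable f) (hfint : Integrable f Q) :
    TendstoInProb μ
      (fun n ω => 1 / (n : ℝ) *
        ∑ i, if A n ω i = a ∧ stratum S (W n ω i) = s then f (W n ω i) else 0)
      (assignProb πA a s * ∫ w in inStratum S s, f w ∂Q) := by
  have hWk : ∀ n k, Measurable fun ω => W n ω k := fun n k =>
    (measurable_pi_apply k).comp (hW.measurable_W n)
  have hAk : ∀ n k, Measurable fun ω => A n ω k := fun n k =>
    (measurable_pi_apply k).comp (hA.measurable_A n)
  have hcell : ∀ n k, MeasurableSet {ω | A n ω k = a ∧ stratum S (W n ω k) = s} := fun n k =>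
    (hAk n k (measurableSet_singleton a)).inter (hWk n k (measurableSet_inStratum hS s))
  have hπ0 := (assignProb_pos hA a s).le
  have hπ1 : assignProb πA a s ≤ 1 := by
    have := hA.target_mem s
    cases a <;> simp [assignProb, this.1.le, this.2.le]
  -- It suffices to compare with bounded functions close to `f` in `L¹`.
  have happrox : ∀ η : ℝ, 0 < η → ∃ g : Participant 𝒵 → ℝ, Measurable g ∧ (∃ K, ∀ w, |g w| ≤ K) ∧
      Integrable g Q ∧ ∫ w, |f w - g w| ∂Q < η := by
    intro η hη
    obtain ⟨g, hg, hgm⟩ := (memLp_one_iff_integrable.2 hfint).exists_simpleFunc_eLpNorm_sub_lt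
      (by simp) (ENNReal.ofReal_pos.2 hη).ne'
    have hgint := memLp_one_iff_integrable.1 hgm
    refine ⟨g, g.measurable, ?_, hgint, ?_⟩
    · obtain ⟨K, hK⟩ := (g.finite_range.image fun r => |r|).bddAbove
      exact ⟨K, fun w => hK ⟨g w, ⟨w, rfl⟩, rfl⟩⟩
    · have hsub := hfint.sub hgint
      rw [eLpNorm_one_eq_lintegral_enorm, ← ofReal_integral_norm_eq_lintegral_enorm hsub] at hg
      simpa using (ENNReal.ofReal_lt_ofReal_iff hη).1 hg
  intro ε hε
  rw [ENNReal.tendsto_nhds_zero]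
  intro δ hδ
  obtain ⟨δ', hδ'0, hδ'⟩ : ∃ δ' : ℝ, 0 < δ' ∧ ENNReal.ofReal δ' ≤ δ := by
    rcases eq_or_ne δ ⊤ with rfl | hδt
    · exact ⟨1, one_pos, le_top⟩
    · exact ⟨δ.toReal, ENNReal.toReal_pos hδ.ne' hδt, by rw [ENNReal.ofReal_toReal hδt]⟩
  -- The first bound keeps the two limits within ε/3 of each other; by Markov's inequality the
  -- second makes the averaged remainder exceed ε/3 with probability at most δ'/2. The passage
  -- through L¹ is needed because Y² is only assumed integrable.
  obtain ⟨g, hg, ⟨K, hK⟩, hgint, hfg⟩ := happrox (min (ε / 3) (ε / 3 * (δ' / 2)))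
    (lt_min (by positivity) (by positivity))
  have hd : Integrable (fun w => f w - g w) Q := hfint.sub hgint
  have hlim : |assignProb πA a s * ∫ w in inStratum S s, f w ∂Q
      - assignProb πA a s * ∫ w in inStratum S s, g w ∂Q| ≤ ε / 3 := by
    rw [← mul_sub, ← integral_sub hfint.integrableOn hgint.integrableOn, abs_mul,
      abs_of_nonneg hπ0]
    have h1 : |∫ w in inStratum S s, (f w - g w) ∂Q| ≤ ∫ w, |f w - g w| ∂Q :=
      abs_integral_le_integral_abs.trans
        (setIntegral_le_integral hd.abs (Eventually.of_forall fun w => abs_nonneg _))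
    calc assignProb πA a s * |∫ w in inStratum S s, (f w - g w) ∂Q|
        ≤ 1 * (ε / 3) := by
          gcongr
          exact h1.trans (hfg.le.trans (min_le_left _ _))
      _ = ε / 3 := one_mul _
  have hbdd := tendstoInProb_mean_of_bounded hS hW hA a s hg hK (ε / 3) (by positivity)
  have hev := (ENNReal.tendsto_nhds_zero.1 hbdd) (ENNReal.ofReal (δ' / 2))
    (ENNReal.ofReal_pos.2 (by positivity))
  filter_upwards [hev] with n hn
  let R : Ω n → ℝ := fun ω => 1 / (n : ℝ) *
    ∑ i, if A n ω i = a ∧ stratum S (W n ω i) = s then f (W n ω i) - g (W n ω i) else 0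
  have hdi : ∀ i, Integrable (fun ω => f (W n ω i) - g (W n ω i)) (μ n) := by
    intro i
    have h2 := hd
    rw [← hW.law n i] at h2
    exact h2.comp_measurable (hWk n i)
  have hterm : ∀ i, Integrable (fun ω => if A n ω i = a ∧ stratum S (W n ω i) = s
      then f (W n ω i) - g (W n ω i) else 0) (μ n) := by
    intro i
    refine ((hdi i).indicator (hcell n i)).congr (Eventually.of_forall fun ω => ?_)
    by_cases hω : A n ω i = a ∧ stratum S (W n ω i) = s
    · rw [Set.indicator_of_mem (by exact hω)]
      exact (if_pos hω).symm
    · rw [Set.indicator_of_notMem (by exact hω)]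
      exact (if_neg hω).symm
  have hRint : Integrable R (μ n) := (integrable_finsetSum _ fun i _ => hterm i).const_mul _
  have hRle : ∫ ω, |R ω| ∂(μ n) ≤ ε / 3 * (δ' / 2) := by
    have hb : ∀ ω, |R ω| ≤ 1 / (n : ℝ) * ∑ i, |f (W n ω i) - g (W n ω i)| := by
      intro ω
      simp only [R, abs_mul]
      rw [abs_of_nonneg (by positivity : (0 : ℝ) ≤ 1 / n)]
      gcongr
      refine (Finset.abs_sum_le_sum_abs _ _).trans (Finset.sum_le_sum fun i _ => ?_)
      split_ifs
      · exact le_rfl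
      · simp
    have hbi : Integrable (fun ω => 1 / (n : ℝ) * ∑ i, |f (W n ω i) - g (W n ω i)|) (μ n) :=
      (integrable_finsetSum _ fun i _ => (hdi i).abs).const_mul _
    refine (integral_mono hRint.abs hbi hb).trans ?_
    rw [integral_const_mul, integral_finsetSum _ fun i _ => (hdi i).abs]
    have heq : ∀ i, ∫ ω, |f (W n ω i) - g (W n ω i)| ∂(μ n) = ∫ w, |f w - g w| ∂Q := by
      intro i
      rw [← hW.law n i, integral_map (f := fun w => |f w - g w|)
        (hWk n i).aemeasurable (hf.sub hg).norm.aestronglyMeasurable]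
    simp only [heq, Finset.sum_const, Finset.card_univ, Fintype.card_fin, nsmul_eq_mul]
    have hI0 : 0 ≤ ∫ w, |f w - g w| ∂Q := integral_nonneg fun w => abs_nonneg _
    have hle : 1 / (n : ℝ) * (n * ∫ w, |f w - g w| ∂Q) ≤ ∫ w, |f w - g w| ∂Q := by
      rcases Nat.eq_zero_or_pos n with rfl | hn0
      · simpa using hI0
      · field_simp
        exact le_rfl
    exact hle.trans (hfg.le.trans (min_le_right _ _))
  have hRmeas := measure_le_abs_le hRint (by positivity : 0 < ε / 3) hRle
  rw [mul_div_cancel_left₀ _ (by positivity : ε / 3 ≠ 0)] at hRmeas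
  refine le_trans ?_ hδ'
  rw [← add_halves δ', ENNReal.ofReal_add (by positivity) (by positivity)]
  refine le_trans (measure_mono ?_) ((measure_union_le _ _).trans (add_le_add hRmeas hn))
  intro ω hω
  -- Off both bad events, the remainder, the error of the bounded average and the gap between the
  -- limits cannot add up to ε.
  by_contra hcon
  simp only [Set.mem_union, Set.mem_ofPred_eq, not_or, not_le] at hcon hω
  have hsplit : 1 / (n : ℝ) *
        ∑ i, (if A n ω i = a ∧ stratum S (W n ω i) = s then f (W n ω i) else 0)
      = R ω + 1 / (n : ℝ) *
        ∑ i, (if A n ω i = a ∧ stratum S (W n ω i) = s then g (W n ω i) else 0) := by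
    simp only [R]
    rw [← mul_add, ← Finset.sum_add_distrib]
    congr 1
    refine Finset.sum_congr rfl fun i _ => ?_
    split_ifs <;> ring
  rw [hsplit] at hω
  have h1 := abs_lt.1 hcon.1
  have h2 := abs_lt.1 hcon.2
  have h3 := abs_le.1 hlim
  rcases le_abs.1 hω with h | h <;> linarith

end LawOfLargeNumbers

/-! ### Finite-sample algebra: every statistic in terms of cell moments. -/

namespace Sample

variable {n : ℕ} {𝒮 : Type*} [DecidableEq 𝒮] (x : Sample n 𝒮)

/-- `(1/n) ∑ᵢ I{Dᵢ = d, Aᵢ = a, Sᵢ = s} Yᵢ ^ k`. -/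
noncomputable def cellMoment (k : ℕ) (d a : Bool) (s : 𝒮) : ℝ :=
  1 / n * ∑ i, if x.D i = d ∧ x.A i = a ∧ x.S i = s then x.Y i ^ k else 0

/-- `(1/n) ∑ᵢ I{Aᵢ = a, Sᵢ = s} Yᵢ ^ k`. -/
noncomputable def armMoment (k : ℕ) (a : Bool) (s : 𝒮) : ℝ :=
  x.cellMoment k true a s + x.cellMoment k false a s

/-- The share of treated within an assignment arm of a stratum. -/
noncomputable def takeUp (a : Bool) (s : 𝒮) : ℝ := x.cellMoment 0 true a s / x.armMoment 0 a s

/-- The mean outcome within an assignment arm of a stratum. -/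
noncomputable def armMean (a : Bool) (s : 𝒮) : ℝ := x.armMoment 1 a s / x.armMoment 0 a s

/-- The stratum-specific Wald ratio. -/
noncomputable def wald (s : 𝒮) : ℝ :=
  (x.armMean true s - x.armMean false s) / (x.takeUp true s - x.takeUp false s)

theorem mul_cellMoment (k : ℕ) (d a : Bool) (s : 𝒮) :
    n * x.cellMoment k d a s
      = ∑ i, if x.D i = d ∧ x.A i = a ∧ x.S i = s then x.Y i ^ k else 0 := by
  rcases Nat.eq_zero_or_pos n with rfl | hn
  · simp
  · rw [cellMoment]
    field_simp

theorem mul_armMoment (k : ℕ) (a : Bool) (s : 𝒮) :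
    n * x.armMoment k a s = ∑ i, if x.A i = a ∧ x.S i = s then x.Y i ^ k else 0 := by
  rw [armMoment, mul_add, mul_cellMoment, mul_cellMoment, ← Finset.sum_add_distrib]
  refine Finset.sum_congr rfl fun i _ => ?_
  cases x.D i <;> simp

theorem mul_armMoment_add (k : ℕ) (s : 𝒮) :
    n * (x.armMoment k true s + x.armMoment k false s)
      = ∑ i, if x.S i = s then x.Y i ^ k else 0 := by
  rw [mul_add, mul_armMoment, mul_armMoment, ← Finset.sum_add_distrib]
  refine Finset.sum_congr rfl fun i _ => ?_
  cases x.A i <;> simp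

theorem nS_eq (s : 𝒮) : x.nS s = n * (x.armMoment 0 true s + x.armMoment 0 false s) := by
  simp [mul_armMoment_add, nS]

theorem nA_eq (s : 𝒮) : x.nA s = n * x.armMoment 0 true s := by
  simp [mul_armMoment, nA]

theorem nAD_eq (s : 𝒮) : x.nAD s = n * x.cellMoment 0 true true s := by
  simp [mul_cellMoment, nAD, and_left_comm]

theorem nD_eq (s : 𝒮) :
    x.nD s = n * (x.cellMoment 0 true true s + x.cellMoment 0 true false s) := by
  rw [mul_add, mul_cellMoment, mul_cellMoment, ← Finset.sum_add_distrib, nD]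
  refine Finset.sum_congr rfl fun i _ => ?_
  cases x.A i <;> simp

variable {x}

theorem r1_eq (hn : n ≠ 0) (s : 𝒮) : x.r1 s = x.takeUp true s := by
  rw [r1, nAD_eq, nA_eq, mul_div_mul_left _ _ (by exact_mod_cast hn), takeUp]

theorem r0_eq (hn : n ≠ 0) (s : 𝒮) : x.r0 s = x.takeUp false s := by
  rw [r0, nAD_eq, nA_eq, nD_eq, nS_eq, ← mul_sub, ← mul_sub, add_sub_cancel_left,
    add_sub_cancel_left, mul_div_mul_left _ _ (by exact_mod_cast hn), takeUp]

variable [Fintype 𝒮]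

theorem matX_mulVec (v : 𝒮 ⊕ 𝒮 → ℝ) (i : Fin n) :
    x.matX.mulVec v i
      = v (Sum.inl (x.S i)) + (if x.D i = true then 1 else 0) * v (Sum.inr (x.S i)) := by
  simp only [Matrix.mulVec, dotProduct, matX, Matrix.of_apply, Fintype.sum_sum_type]
  congr 1
  · simp
  · cases x.D i <;> simp

theorem matZ_transpose_mulVec_inl (u : Fin n → ℝ) (s : 𝒮) :
    x.matZ.transpose.mulVec u (Sum.inl s) = ∑ i, if x.S i = s then u i else 0 := by
  simp [Matrix.mulVec, dotProduct, matZ]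

theorem matZ_transpose_mulVec_inr (u : Fin n → ℝ) (s : 𝒮) :
    x.matZ.transpose.mulVec u (Sum.inr s)
      = ∑ i, if x.A i = true ∧ x.S i = s then u i else 0 := by
  simp [Matrix.mulVec, dotProduct, matZ]

theorem normalMatrix_mulVec_inl (v : 𝒮 ⊕ 𝒮 → ℝ) (s : 𝒮) :
    (x.matZ.transpose * x.matX).mulVec v (Sum.inl s)
      = x.nS s * v (Sum.inl s) + x.nD s * v (Sum.inr s) := by
  rw [← Matrix.mulVec_mulVec, matZ_transpose_mulVec_inl, nS, nD, Finset.sum_mul, Finset.sum_mul,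
    ← Finset.sum_add_distrib]
  refine Finset.sum_congr rfl fun i _ => ?_
  rw [matX_mulVec]
  by_cases h : x.S i = s <;> simp [h]

theorem normalMatrix_mulVec_inr (v : 𝒮 ⊕ 𝒮 → ℝ) (s : 𝒮) :
    (x.matZ.transpose * x.matX).mulVec v (Sum.inr s)
      = x.nA s * v (Sum.inl s) + x.nAD s * v (Sum.inr s) := by
  rw [← Matrix.mulVec_mulVec, matZ_transpose_mulVec_inr, nA, nAD, Finset.sum_mul, Finset.sum_mul,
    ← Finset.sum_add_distrib]
  refine Finset.sum_congr rfl fun i _ => ?_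
  rw [matX_mulVec]
  by_cases h : x.S i = s <;> by_cases h' : x.A i = true <;> simp [h, h']

/-- In a sample with both arms in every stratum and with a first stage, the IV coefficients are the
stratum-specific Wald ratios and intercepts. -/
theorem ivCoef_eq (hn : n ≠ 0) (harm : ∀ a s, x.armMoment 0 a s ≠ 0)
    (hfs : ∀ s, x.takeUp true s - x.takeUp false s ≠ 0) :
    x.ivCoef = Sum.elim (fun s => x.armMean true s - x.takeUp true s * x.wald s) x.wald := by
  have hn' : (n : ℝ) ≠ 0 := by exact_mod_cast hn
  have hcell : ∀ a s, x.cellMoment 0 true a s = x.armMoment 0 a s * x.takeUp a s := fun a s => by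
    rw [takeUp, mul_div_cancel₀ _ (harm a s)]
  have hmean : ∀ a s, x.armMoment 1 a s = x.armMoment 0 a s * x.armMean a s := fun a s => by
    rw [armMean, mul_div_cancel₀ _ (harm a s)]
  have hunit : IsUnit (x.matZ.transpose * x.matX) := by
    -- Invertibility follows from a trivial kernel: the system decouples into one 2 × 2 system per
    -- stratum.
    rw [← Matrix.mulVec_injective_iff_isUnit]
    refine (injective_iff_map_eq_zero (x.matZ.transpose * x.matX).mulVecLin).2 fun v hv => ?_
    have h1 : ∀ s, x.nS s * v (Sum.inl s) + x.nD s * v (Sum.inr s) = 0 := fun s => by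
      rw [← normalMatrix_mulVec_inl]
      exact congrFun hv (Sum.inl s)
    have h2 : ∀ s, x.nA s * v (Sum.inl s) + x.nAD s * v (Sum.inr s) = 0 := fun s => by
      rw [← normalMatrix_mulVec_inr]
      exact congrFun hv (Sum.inr s)
    have h3 : ∀ s, v (Sum.inl s) + x.takeUp true s * v (Sum.inr s) = 0 := fun s => by
      have := h2 s
      rw [nA_eq, nAD_eq, hcell] at this
      refine (mul_eq_zero.1 (?_ : (n * x.armMoment 0 true s) * _ = 0)).resolve_left
        (mul_ne_zero hn' (harm true s))
      linear_combination this
    -- Subtracting the equation of the assigned arm from that of the whole stratum leaves the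
    -- control arm.
    have h4 : ∀ s, v (Sum.inl s) + x.takeUp false s * v (Sum.inr s) = 0 := fun s => by
      have h1 := h1 s
      have h2 := h2 s
      rw [nS_eq, nD_eq, hcell, hcell] at h1
      rw [nA_eq, nAD_eq, hcell] at h2
      refine (mul_eq_zero.1 (?_ : (n * x.armMoment 0 false s) * _ = 0)).resolve_left
        (mul_ne_zero hn' (harm false s))
      linear_combination h1 - h2
    have h5 : ∀ s, v (Sum.inr s) = 0 := fun s => by
      refine (mul_eq_zero.1 (?_ : (x.takeUp true s - x.takeUp false s) * _ = 0)).resolve_left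
        (hfs s)
      linear_combination h3 s - h4 s
    funext j
    rcases j with s | s
    · simpa [h5] using h3 s
    · exact h5 s
  have hsol : (x.matZ.transpose * x.matX).mulVec
      (Sum.elim (fun s => x.armMean true s - x.takeUp true s * x.wald s) x.wald)
      = x.matZ.transpose.mulVec x.Y := by
    have hw : ∀ s, x.wald s * (x.takeUp true s - x.takeUp false s)
        = x.armMean true s - x.armMean false s := fun s => by
      rw [wald, div_mul_cancel₀ _ (hfs s)]
    funext j
    rcases j with s | s
    · have hy := x.mul_armMoment_add 1 s
      simp only [pow_one] at hy
      rw [normalMatrix_mulVec_inl, matZ_transpose_mulVec_inl, ← hy, nS_eq, nD_eq, hcell, hcell,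
        hmean, hmean]
      simp only [Sum.elim_inl, Sum.elim_inr]
      linear_combination (-(n : ℝ) * x.armMoment 0 false s) * hw s
    · have hy := x.mul_armMoment 1 true s
      simp only [pow_one] at hy
      rw [normalMatrix_mulVec_inr, matZ_transpose_mulVec_inr, ← hy, nA_eq, nAD_eq, hcell, hmean]
      simp only [Sum.elim_inl, Sum.elim_inr]
      ring
  rw [ivCoef, ← hsol, Matrix.mulVec_mulVec,
    Matrix.nonsing_inv_mul _ ((Matrix.isUnit_iff_isUnit_det _).1 hunit), Matrix.one_mulVec]

/-- Within a cell the fitted value is constant, so the shifted residual is `Y - κ` and its square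
expands into three cell moments. -/
theorem cellMeanSq_eq (d a : Bool) (s : 𝒮) (c κ : ℝ)
    (hκ : κ = x.gammaHatAt s + (if d = true then 1 else 0) * x.betaHatAt s - c) :
    x.cellMeanSq d a s c = x.cellMoment 2 d a s - 2 * κ * x.cellMoment 1 d a s
      + κ ^ 2 * x.cellMoment 0 d a s := by
  simp only [cellMeanSq, cellMoment]
  rw [mul_left_comm (2 * κ), mul_left_comm (κ ^ 2), ← mul_sub, ← mul_add, Finset.mul_sum _ _ (2 * κ),
    Finset.mul_sum _ _ (κ ^ 2), ← Finset.sum_sub_distrib, ← Finset.sum_add_distrib]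
  congr 1
  refine Finset.sum_congr rfl fun i _ => ?_
  by_cases h : x.D i = d ∧ x.A i = a ∧ x.S i = s
  · obtain ⟨h1, h2, h3⟩ := h
    have hr : x.resid i + c = x.Y i - κ := by
      rw [resid, hκ]
      simp only [h1, h3, ite_mul, mul_ite, one_mul, mul_one, zero_mul, mul_zero,
        Finset.sum_ite_eq, Finset.mem_univ, if_true]
      cases d <;> simp <;> ring
    simp only [h1, h2, h3, and_self, if_true, hr]
    ring
  · simp [h]

end Sample

/-! ### Conditional moments weighted by the probability of the event. -/

section Conditioning

variable {𝒵 : Type*} [MeasurableSpace 𝒵] {Q : Measure (Participant 𝒵)} [IsProbabilityMeasure Q]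

/-- In this product form the identity also holds on null events, which covers strata without always
takers or never takers. -/
theorem measureReal_mul_condMean (f : Participant 𝒵 → ℝ) (E : Set (Participant 𝒵)) :
    Q.real E * condMean Q f E = ∫ w in E, f w ∂Q := by
  rw [condMean, ProbabilityTheory.cond, integral_smul_measure, smul_eq_mul]
  by_cases hE : Q E = 0
  · rw [setIntegral_measure_zero _ hE, mul_zero, mul_zero]
  · have h : Q.real E ≠ 0 := by
      rw [measureReal_def, ENNReal.toReal_ne_zero]
      exact ⟨hE, measure_ne_top _ _⟩
    rw [ENNReal.toReal_inv, ← measureReal_def, ← mul_assoc, mul_inv_cancel₀ h, one_mul]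

theorem measureReal_mul_condVar_add {f : Participant 𝒵 → ℝ} (hf : MemLp f 2 Q)
    (E : Set (Participant 𝒵)) :
    Q.real E * (SatIV.condVar Q f E + condMean Q f E ^ 2) = ∫ w in E, f w ^ 2 ∂Q := by
  rw [← measureReal_mul_condMean]
  by_cases hE : Q E = 0
  · simp [measureReal_def, hE]
  · have := cond_isProbabilityMeasure hE
    have hfE : MemLp f 2 (ProbabilityTheory.cond Q E) := by
      rw [ProbabilityTheory.cond]
      exact (hf.mono_measure Measure.restrict_le_self).smul_measure (ENNReal.inv_ne_top.2 hE)
    rw [SatIV.condVar, variance_eq_sub hfE, condMean, condMean]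
    simp

end Conditioning

/-! ### Cell means in terms of compliers, always takers and never takers. -/

section Types

variable {𝒵 𝒮 : Type*} [MeasurableSpace 𝒵] [MeasurableSpace 𝒮]
  [MeasurableSingletonClass 𝒮]
  {S : 𝒵 → 𝒮} {Q : Measure (Participant 𝒵)}
  {Ω : ℕ → Type*} [∀ n, MeasurableSpace (Ω n)]
  {μ : ∀ n, Measure (Ω n)}
  {W : ∀ n, Ω n → Fin n → Participant 𝒵}

theorem measurableSet_compliers : MeasurableSet (compliers 𝒵) :=
  (measurableSet_potD false false).inter (measurableSet_potD true true)

theorem measurableSet_alwaysTakers : MeasurableSet (alwaysTakers 𝒵) :=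
  (measurableSet_potD false true).inter (measurableSet_potD true true)

theorem measurableSet_neverTakers : MeasurableSet (neverTakers 𝒵) :=
  (measurableSet_potD false false).inter (measurableSet_potD true false)

theorem memLp_potY (hW : DataAssumption μ Q S W) (d : Bool) : MemLp (potY d) 2 Q :=
  (memLp_two_iff_integrable_sq (measurable_potY d).aestronglyMeasurable).2 (hW.sq_integrable d)

variable [IsProbabilityMeasure Q]

theorem integrable_potY_pow (hW : DataAssumption μ Q S W) (d : Bool) {k : ℕ} (hk : k ≤ 2) :
    Integrable (fun w => potY d w ^ k) Q := by
  interval_cases k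
  · simp
  · simpa using (memLp_potY hW d).integrable one_le_two
  · exact hW.sq_integrable d

/-- The conditional moment `E[Y(d) ^ k | T, S = s]`, for `k ≤ 2`. -/
noncomputable def typeMoment (Q : Measure (Participant 𝒵)) (S : 𝒵 → 𝒮) (k : ℕ) (d : Bool)
    (T : Set (Participant 𝒵)) (s : 𝒮) : ℝ :=
  match k with
  | 0 => 1
  | 1 => meanY Q S d T s
  | _ => varY Q S d T s + meanY Q S d T s ^ 2

theorem setIntegral_potY_pow (hW : DataAssumption μ Q S W) (d : Bool) {k : ℕ} (hk : k ≤ 2)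
    (T : Set (Participant 𝒵)) (s : 𝒮) :
    ∫ w in T ∩ inStratum S s, potY d w ^ k ∂Q
      = Q.real (T ∩ inStratum S s) * typeMoment Q S k d T s := by
  interval_cases k
  · simp [typeMoment]
  · simp only [pow_one]
    exact (measureReal_mul_condMean (potY d) (T ∩ inStratum S s)).symm
  · exact (measureReal_mul_condVar_add (memLp_potY hW d) (T ∩ inStratum S s)).symm

/-- `E[Y(d) ^ k 1{D(a) = d, S = s}]`. -/
noncomputable def cellMean (Q : Measure (Participant 𝒵)) (S : 𝒵 → 𝒮) (k : ℕ) (d a : Bool)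
    (s : 𝒮) : ℝ :=
  ∫ w in {w | potD a w = d} ∩ inStratum S s, potY d w ^ k ∂Q

theorem p_mul_piD (hS : Measurable S) (hW : DataAssumption μ Q S W) (a : Bool) (s : 𝒮) :
    p Q S s * piD Q S a s = Q.real ({w | potD a w = true} ∩ inStratum S s) := by
  have hp : p Q S s ≠ 0 := (hW.p_pos s).ne'
  rw [piD, measureReal_def, ProbabilityTheory.cond_apply (measurableSet_inStratum hS s),
    ENNReal.toReal_mul, ENNReal.toReal_inv, ← measureReal_def, ← measureReal_def,
    Set.inter_comm]
  change p Q S s * ((p Q S s)⁻¹ * _) = _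
  rw [← mul_assoc, mul_inv_cancel₀ hp, one_mul]

theorem measureReal_alwaysTakers (hS : Measurable S) (hW : DataAssumption μ Q S W) (s : 𝒮) :
    Q.real (alwaysTakers 𝒵 ∩ inStratum S s) = p Q S s * piD Q S false s := by
  rw [p_mul_piD hS hW]
  refine measureReal_congr ?_
  filter_upwards [measure_eq_zero_iff_ae_notMem.1 hW.no_defiers] with w hw
  refine propext ?_
  change ((potD false w = true ∧ potD true w = true) ∧ stratum S w = s)
    ↔ (potD false w = true ∧ stratum S w = s)
  change ¬ (potD false w = true ∧ potD true w = false) at hw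
  cases h : potD true w <;> simp_all

/-- The event D(1) = 1 splits by D(0) into always takers and compliers, and the always takers have
mass p(s) π_{D(0)}(s) because defiers are null. -/
theorem measureReal_compliers (hS : Measurable S) (hW : DataAssumption μ Q S W) (s : 𝒮) :
    Q.real (compliers 𝒵 ∩ inStratum S s)
      = p Q S s * (piD Q S true s - piD Q S false s) := by
  have hE := measurableSet_inStratum hS s
  rw [mul_sub, p_mul_piD hS hW, ← measureReal_alwaysTakers hS hW,
    ← measureReal_inter_add_sdiff (s := {w | potD true w = true} ∩ inStratum S s)
      (measurableSet_potD (𝒵 := 𝒵) false true)]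
  have h1 : {w : Participant 𝒵 | potD true w = true} ∩ inStratum S s ∩ {w | potD false w = true}
      = alwaysTakers 𝒵 ∩ inStratum S s := by
    ext w
    simp only [alwaysTakers, Set.mem_inter_iff, Set.mem_ofPred_eq]
    tauto
  have h2 : ({w : Participant 𝒵 | potD true w = true} ∩ inStratum S s) \ {w | potD false w = true}
      = compliers 𝒵 ∩ inStratum S s := by
    ext w
    simp only [compliers, Set.mem_inter_iff, Set.mem_sdiff, Set.mem_ofPred_eq, Bool.not_eq_true]
    tauto
  rw [h1, h2]
  ring

theorem measureReal_neverTakers (hS : Measurable S) (hW : DataAssumption μ Q S W) (s : 𝒮) :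
    Q.real (neverTakers 𝒵 ∩ inStratum S s) = p Q S s * (1 - piD Q S true s) := by
  have h0 : Q.real (neverTakers 𝒵 ∩ inStratum S s)
      = Q.real (inStratum S s \ {w | potD true w = true}) := by
    refine measureReal_congr ?_
    filter_upwards [measure_eq_zero_iff_ae_notMem.1 hW.no_defiers] with w hw
    refine propext ?_
    change ((potD false w = false ∧ potD true w = false) ∧ stratum S w = s)
      ↔ (stratum S w = s ∧ ¬ potD true w = true)
    change ¬ (potD false w = true ∧ potD true w = false) at hw
    cases h : potD true w <;> simp_all
  have h1 := measureReal_inter_add_sdiff (μ := Q) (s := inStratum S s)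
    (measurableSet_potD (𝒵 := 𝒵) true true)
  rw [h0, mul_sub, mul_one, p_mul_piD hS hW, Set.inter_comm {w | potD true w = true}]
  change _ = Q.real (inStratum S s) - _
  linarith

/-- Treated participants of the assigned arm are a mixture of compliers and always takers; this
mixture is the source of the Δ₁² term of V_{Y,1}. -/
theorem cellMean_true_true (hS : Measurable S) (hW : DataAssumption μ Q S W) {k : ℕ} (hk : k ≤ 2)
    (s : 𝒮) :
    cellMean Q S k true true s
      = p Q S s * (piD Q S true s - piD Q S false s) * typeMoment Q S k true (compliers 𝒵) s
        + p Q S s * piD Q S false s * typeMoment Q S k true (alwaysTakers 𝒵) s := by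
  have hE := measurableSet_inStratum hS s
  have hset : {w : Participant 𝒵 | potD true w = true} ∩ inStratum S s
      = (compliers 𝒵 ∩ inStratum S s) ∪ (alwaysTakers 𝒵 ∩ inStratum S s) := by
    ext w
    simp only [compliers, alwaysTakers, Set.mem_inter_iff, Set.mem_union, Set.mem_ofPred_eq]
    cases potD false w <;> simp
  rw [cellMean, hset, setIntegral_union _ (measurableSet_alwaysTakers.inter hE)
    (integrable_potY_pow hW true hk).integrableOn (integrable_potY_pow hW true hk).integrableOn,
    setIntegral_potY_pow hW true hk, setIntegral_potY_pow hW true hk,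
    measureReal_compliers hS hW, measureReal_alwaysTakers hS hW]
  refine Set.disjoint_left.2 fun w hw hw' => ?_
  have := hw.1.1.symm.trans hw'.1.1
  simp at this

theorem cellMean_false_false (hS : Measurable S) (hW : DataAssumption μ Q S W) {k : ℕ}
    (hk : k ≤ 2) (s : 𝒮) :
    cellMean Q S k false false s
      = p Q S s * (piD Q S true s - piD Q S false s) * typeMoment Q S k false (compliers 𝒵) s
        + p Q S s * (1 - piD Q S true s) * typeMoment Q S k false (neverTakers 𝒵) s := by
  have hE := measurableSet_inStratum hS s
  have hset : {w : Participant 𝒵 | potD false w = false} ∩ inStratum S s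
      = (compliers 𝒵 ∩ inStratum S s) ∪ (neverTakers 𝒵 ∩ inStratum S s) := by
    ext w
    simp only [compliers, neverTakers, Set.mem_inter_iff, Set.mem_union, Set.mem_ofPred_eq]
    cases potD true w <;> simp
  rw [cellMean, hset, setIntegral_union _ (measurableSet_neverTakers.inter hE)
    (integrable_potY_pow hW false hk).integrableOn (integrable_potY_pow hW false hk).integrableOn,
    setIntegral_potY_pow hW false hk, setIntegral_potY_pow hW false hk,
    measureReal_compliers hS hW, measureReal_neverTakers hS hW]
  refine Set.disjoint_left.2 fun w hw hw' => ?_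
  have := hw.1.2.symm.trans hw'.1.2
  simp at this

/-- Without defiers, treatment in the control arm identifies always takers up to a null set. -/
theorem cellMean_true_false (hS : Measurable S) (hW : DataAssumption μ Q S W) {k : ℕ} (hk : k ≤ 2)
    (s : 𝒮) :
    cellMean Q S k true false s
      = p Q S s * piD Q S false s * typeMoment Q S k true (alwaysTakers 𝒵) s := by
  rw [← measureReal_alwaysTakers hS hW, ← setIntegral_potY_pow hW true hk, cellMean]
  refine setIntegral_congr_set ?_
  filter_upwards [measure_eq_zero_iff_ae_notMem.1 hW.no_defiers] with w hw
  refine propext ?_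
  change (potD false w = true ∧ stratum S w = s)
    ↔ ((potD false w = true ∧ potD true w = true) ∧ stratum S w = s)
  change ¬ (potD false w = true ∧ potD true w = false) at hw
  cases h : potD true w <;> simp_all

theorem cellMean_false_true (hS : Measurable S) (hW : DataAssumption μ Q S W) {k : ℕ} (hk : k ≤ 2)
    (s : 𝒮) :
    cellMean Q S k false true s
      = p Q S s * (1 - piD Q S true s) * typeMoment Q S k false (neverTakers 𝒵) s := by
  rw [← measureReal_neverTakers hS hW, ← setIntegral_potY_pow hW false hk, cellMean]
  refine setIntegral_congr_set ?_
  filter_upwards [measure_eq_zero_iff_ae_notMem.1 hW.no_defiers] with w hw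
  refine propext ?_
  change (potD true w = false ∧ stratum S w = s)
    ↔ ((potD false w = false ∧ potD true w = false) ∧ stratum S w = s)
  change ¬ (potD false w = true ∧ potD true w = false) at hw
  cases h : potD true w <;> simp_all

theorem lateAt_eq (hS : Measurable S) (hW : DataAssumption μ Q S W) (s : 𝒮) :
    lateAt Q S s = meanY Q S true (compliers 𝒵) s - meanY Q S false (compliers 𝒵) s := by
  have hpos : 0 < Q.real (compliers 𝒵 ∩ inStratum S s) := by
    rw [measureReal_compliers hS hW]
    exact mul_pos (hW.p_pos s) (hW.compliers_pos s)
  have hi : ∀ d, Integrable (potY (𝒵 := 𝒵) d) Q := fun d => (memLp_potY hW d).integrable one_le_two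
  refine mul_left_cancel₀ hpos.ne' ?_
  rw [mul_sub, lateAt, meanY, meanY, measureReal_mul_condMean, measureReal_mul_condMean,
    measureReal_mul_condMean, integral_sub (hi _).integrableOn (hi _).integrableOn]

variable [Fintype 𝒮]

theorem setIntegral_compliers (hS : Measurable S) {f : Participant 𝒵 → ℝ} (hf : Integrable f Q) :
    ∫ w in compliers 𝒵, f w ∂Q = ∑ s, ∫ w in compliers 𝒵 ∩ inStratum S s, f w ∂Q := by
  have hU : compliers 𝒵 = ⋃ s, compliers 𝒵 ∩ inStratum S s := by
    ext w
    simp [inStratum]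
  conv_lhs => rw [hU]
  refine integral_iUnion_fintype
    (fun s => measurableSet_compliers.inter (measurableSet_inStratum hS s)) ?_
    fun s => hf.integrableOn
  intro s t hst
  exact Set.disjoint_left.2 fun w hw hw' => hst (hw.2.symm.trans hw'.2)

theorem measureReal_compliers_univ (hS : Measurable S) (hW : DataAssumption μ Q S W) :
    Q.real (compliers 𝒵) = probC Q S := by
  have := setIntegral_compliers hS (integrable_const (μ := Q) (1 : ℝ))
  simp only [integral_const, measureReal_restrict_apply_univ, smul_eq_mul, mul_one] at this
  rw [this, probC]
  exact Finset.sum_congr rfl fun s _ => measureReal_compliers hS hW s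

theorem probC_pos (hW : DataAssumption μ Q S W) : 0 < probC Q S := by
  -- Positivity of the sum needs at least one stratum, supplied by any participant.
  obtain ⟨w⟩ : Nonempty (Participant 𝒵) := nonempty_of_isProbabilityMeasure Q
  exact Finset.sum_pos (fun s _ => mul_pos (hW.p_pos s) (hW.compliers_pos s))
    ⟨stratum S w, Finset.mem_univ _⟩

theorem late_eq (hS : Measurable S) (hW : DataAssumption μ Q S W) :
    late Q = ∑ s, p Q S s * (piD Q S true s - piD Q S false s) / probC Q S * lateAt Q S s := by
  have hi : ∀ d, Integrable (potY (𝒵 := 𝒵) d) Q := fun d => (memLp_potY hW d).integrable one_le_two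
  have hpos := probC_pos hW
  refine mul_left_cancel₀ hpos.ne' ?_
  rw [late, ← measureReal_compliers_univ hS hW, measureReal_mul_condMean,
    setIntegral_compliers hS (f := fun w => potY true w - potY false w)
      ((hi true).sub (hi false)), measureReal_compliers_univ hS hW,
    Finset.mul_sum]
  refine Finset.sum_congr rfl fun s _ => ?_
  rw [← measureReal_mul_condMean, measureReal_compliers hS hW]
  change _ * lateAt Q S s = _
  field_simp

end Types

/-! ### Probability limits of the estimators and identification of the variance. -/

section Limits

variable {𝒵 𝒮 : Type*} [MeasurableSpace 𝒵]
  [Fintype 𝒮] [DecidableEq 𝒮] [MeasurableSpace 𝒮] [MeasurableSingletonClass 𝒮]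
  {S : 𝒵 → 𝒮} {Q : Measure (Participant 𝒵)} [IsProbabilityMeasure Q]
  {Ω : ℕ → Type*} [∀ n, MeasurableSpace (Ω n)]
  {μ : ∀ n, Measure (Ω n)} [∀ n, IsProbabilityMeasure (μ n)]
  {W : ∀ n, Ω n → Fin n → Participant 𝒵} {A : ∀ n, Ω n → Fin n → Bool} {πA : 𝒮 → ℝ}

/-- The mean outcome `E[Y(D(a)) | S = s]` under assignment `a`. -/
noncomputable def outcomeMean (Q : Measure (Participant 𝒵)) (S : 𝒵 → 𝒮) (a : Bool) (s : 𝒮) : ℝ :=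
  (piD Q S true s - piD Q S false s) * meanY Q S a (compliers 𝒵) s
    + piD Q S false s * meanY Q S true (alwaysTakers 𝒵) s
    + (1 - piD Q S true s) * meanY Q S false (neverTakers 𝒵) s

theorem cellMean_zero_true (hS : Measurable S) (hW : DataAssumption μ Q S W) (a : Bool) (s : 𝒮) :
    cellMean Q S 0 true a s = p Q S s * piD Q S a s := by
  cases a
  · rw [cellMean_true_false hS hW (by norm_num)]
    simp [typeMoment]
  · rw [cellMean_true_true hS hW (by norm_num)]
    simp only [typeMoment]
    ring

theorem cellMean_zero_false (hS : Measurable S) (hW : DataAssumption μ Q S W) (a : Bool) (s : 𝒮) :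
    cellMean Q S 0 false a s = p Q S s * (1 - piD Q S a s) := by
  cases a
  · rw [cellMean_false_false hS hW (by norm_num)]
    simp only [typeMoment]
    ring
  · rw [cellMean_false_true hS hW (by norm_num)]
    simp [typeMoment]

theorem cellMean_one_add (hS : Measurable S) (hW : DataAssumption μ Q S W) (a : Bool) (s : 𝒮) :
    cellMean Q S 1 true a s + cellMean Q S 1 false a s = p Q S s * outcomeMean Q S a s := by
  cases a
  · rw [cellMean_true_false hS hW (by norm_num), cellMean_false_false hS hW (by norm_num)]
    simp only [typeMoment, outcomeMean]
    ring
  · rw [cellMean_true_true hS hW (by norm_num), cellMean_false_true hS hW (by norm_num)]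
    simp only [typeMoment, outcomeMean]
    ring

variable (W A) in
/-- The observed data, as a function of the sample size and the sample point. -/
def observed (S : 𝒵 → 𝒮) (x : Σ n, Ω n) : Sample x.1 𝒮 := observe S (W x.1 x.2) (A x.1 x.2)

/-- On A = a, D = d the observed data are D(a) and Y(d), so the summand is an assignment indicator
times a function of `W` alone and the law of large numbers applies. -/
theorem tendsto_cellMoment (hS : Measurable S) (hW : DataAssumption μ Q S W)
    (hA : AssignmentAssumption μ S W A πA) {k : ℕ} (hk : k ≤ 2) (d a : Bool) (s : 𝒮) :
    Tendsto (fun x => (observed W A S x).cellMoment k d a s) (inProb μ)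
      (𝓝 (assignProb πA a s * cellMean Q S k d a s)) := by
  have hD := measurableSet_potD (𝒵 := 𝒵) a d
  have h := tendstoInProb_mean hS hW hA a s
    (f := {w | potD a w = d}.indicator fun w => potY d w ^ k)
    (((measurable_potY d).pow_const k).indicator hD)
    ((integrable_potY_pow hW d hk).indicator hD)
  rw [tendstoInProb_iff, setIntegral_indicator hD, Set.inter_comm] at h
  refine h.congr fun x => ?_
  rw [Sample.cellMoment]
  congr 1
  refine Finset.sum_congr rfl fun i _ => ?_
  change _ = if potD (A x.1 x.2 i) (W x.1 x.2 i) = d ∧ A x.1 x.2 i = a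
    ∧ stratum S (W x.1 x.2 i) = s then potY (potD (A x.1 x.2 i) (W x.1 x.2 i)) (W x.1 x.2 i) ^ k
    else 0
  by_cases h1 : A x.1 x.2 i = a
  · by_cases h2 : potD a (W x.1 x.2 i) = d
    · simp [h1, h2, Set.indicator]
    · simp [h1, h2, Set.indicator]
  · simp [h1]

theorem tendsto_armMoment_zero (hS : Measurable S) (hW : DataAssumption μ Q S W)
    (hA : AssignmentAssumption μ S W A πA) (a : Bool) (s : 𝒮) :
    Tendsto (fun x => (observed W A S x).armMoment 0 a s) (inProb μ)
      (𝓝 (assignProb πA a s * p Q S s)) := by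
  have h := (tendsto_cellMoment hS hW hA (Nat.zero_le 2) true a s).add
    (tendsto_cellMoment hS hW hA (Nat.zero_le 2) false a s)
  rw [← mul_add, cellMean_zero_true hS hW, cellMean_zero_false hS hW, ← mul_add,
    add_sub_cancel, mul_one] at h
  exact h

theorem tendsto_takeUp (hS : Measurable S) (hW : DataAssumption μ Q S W)
    (hA : AssignmentAssumption μ S W A πA) (a : Bool) (s : 𝒮) :
    Tendsto (fun x => (observed W A S x).takeUp a s) (inProb μ) (𝓝 (piD Q S a s)) := by
  have hπ := (assignProb_pos hA a s).ne'
  have hp := (hW.p_pos s).ne'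
  have h := (tendsto_cellMoment hS hW hA (Nat.zero_le 2) true a s).div
    (tendsto_armMoment_zero hS hW hA a s) (mul_ne_zero hπ hp)
  rwa [cellMean_zero_true hS hW, ← mul_assoc, mul_div_cancel_left₀ _ (mul_ne_zero hπ hp)] at h

theorem tendsto_armMean (hS : Measurable S) (hW : DataAssumption μ Q S W)
    (hA : AssignmentAssumption μ S W A πA) (a : Bool) (s : 𝒮) :
    Tendsto (fun x => (observed W A S x).armMean a s) (inProb μ) (𝓝 (outcomeMean Q S a s)) := by
  have hπ := (assignProb_pos hA a s).ne'
  have hp := (hW.p_pos s).ne'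
  have h := ((tendsto_cellMoment hS hW hA one_le_two true a s).add
    (tendsto_cellMoment hS hW hA one_le_two false a s)).div
    (tendsto_armMoment_zero hS hW hA a s) (mul_ne_zero hπ hp)
  rwa [← mul_add, cellMean_one_add hS hW, ← mul_assoc,
    mul_div_cancel_left₀ _ (mul_ne_zero hπ hp)] at h

/-- Always takers and never takers contribute equally to both arm means and cancel, leaving the
compliers. -/
theorem tendsto_wald (hS : Measurable S) (hW : DataAssumption μ Q S W)
    (hA : AssignmentAssumption μ S W A πA) (s : 𝒮) :
    Tendsto (fun x => (observed W A S x).wald s) (inProb μ) (𝓝 (lateAt Q S s)) := by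
  have hc := (hW.compliers_pos s).ne'
  have h := ((tendsto_armMean hS hW hA true s).sub (tendsto_armMean hS hW hA false s)).div
    ((tendsto_takeUp hS hW hA true s).sub (tendsto_takeUp hS hW hA false s)) hc
  have hlim : (outcomeMean Q S true s - outcomeMean Q S false s)
      / (piD Q S true s - piD Q S false s) = lateAt Q S s := by
    rw [div_eq_iff hc, lateAt_eq hS hW, outcomeMean, outcomeMean]
    ring
  rw [hlim] at h
  exact h

theorem eventually_size_ne_zero : ∀ᶠ x : Σ n, Ω n in inProb μ, x.1 ≠ 0 :=
  eventually_inProb_of_eventually (eventually_ne_atTop 0)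

/-- Arm shares and first stages have nonzero limits, so the default value of the matrix inverse
matters only with vanishing probability. -/
theorem eventually_ivCoef_eq (hS : Measurable S) (hW : DataAssumption μ Q S W)
    (hA : AssignmentAssumption μ S W A πA) :
    ∀ᶠ x in inProb μ, (observed W A S x).ivCoef
      = Sum.elim (fun s => (observed W A S x).armMean true s
          - (observed W A S x).takeUp true s * (observed W A S x).wald s)
        (observed W A S x).wald := by
  have h1 : ∀ᶠ x in inProb μ, ∀ a s, (observed W A S x).armMoment 0 a s ≠ 0 :=
    eventually_all.2 fun a => eventually_all.2 fun s =>
      (tendsto_armMoment_zero hS hW hA a s).eventually_ne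
        (mul_ne_zero (assignProb_pos hA a s).ne' (hW.p_pos s).ne')
  have h2 : ∀ᶠ x in inProb μ, ∀ s,
      (observed W A S x).takeUp true s - (observed W A S x).takeUp false s ≠ 0 :=
    eventually_all.2 fun s =>
      ((tendsto_takeUp hS hW hA true s).sub (tendsto_takeUp hS hW hA false s)).eventually_ne
        (hW.compliers_pos s).ne'
  filter_upwards [eventually_size_ne_zero, h1, h2] with x hx h1 h2
  exact Sample.ivCoef_eq hx h1 h2

theorem tendsto_betaHatAt (hS : Measurable S) (hW : DataAssumption μ Q S W)
    (hA : AssignmentAssumption μ S W A πA) (s : 𝒮) :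
    Tendsto (fun x => (observed W A S x).betaHatAt s) (inProb μ) (𝓝 (lateAt Q S s)) := by
  refine (tendsto_wald hS hW hA s).congr' ?_
  filter_upwards [eventually_ivCoef_eq hS hW hA] with x hx
  rw [Sample.betaHatAt, hx, Sum.elim_inr]

theorem tendsto_gammaHatAt (hS : Measurable S) (hW : DataAssumption μ Q S W)
    (hA : AssignmentAssumption μ S W A πA) (s : 𝒮) :
    Tendsto (fun x => (observed W A S x).gammaHatAt s) (inProb μ)
      (𝓝 (outcomeMean Q S true s - piD Q S true s * lateAt Q S s)) := by
  refine ((tendsto_armMean hS hW hA true s).sub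
    ((tendsto_takeUp hS hW hA true s).mul (tendsto_wald hS hW hA s))).congr' ?_
  filter_upwards [eventually_ivCoef_eq hS hW hA] with x hx
  rw [Sample.gammaHatAt, hx, Sum.elim_inl]

theorem tendsto_r1 (hS : Measurable S) (hW : DataAssumption μ Q S W)
    (hA : AssignmentAssumption μ S W A πA) (s : 𝒮) :
    Tendsto (fun x => (observed W A S x).r1 s) (inProb μ) (𝓝 (piD Q S true s)) := by
  refine (tendsto_takeUp hS hW hA true s).congr' ?_
  filter_upwards [eventually_size_ne_zero] with x hx
  rw [Sample.r1_eq hx]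

theorem tendsto_r0 (hS : Measurable S) (hW : DataAssumption μ Q S W)
    (hA : AssignmentAssumption μ S W A πA) (s : 𝒮) :
    Tendsto (fun x => (observed W A S x).r0 s) (inProb μ) (𝓝 (piD Q S false s)) := by
  refine (tendsto_takeUp hS hW hA false s).congr' ?_
  filter_upwards [eventually_size_ne_zero] with x hx
  rw [Sample.r0_eq hx]

theorem tendsto_nS_div (hS : Measurable S) (hW : DataAssumption μ Q S W) (s : 𝒮) :
    Tendsto (fun x => (observed W A S x).nS s / x.1) (inProb μ) (𝓝 (p Q S s)) := by
  have h := tendstoInProb_stratum_share hS hW s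
  rw [tendstoInProb_iff] at h
  refine h.congr fun x => ?_
  rw [one_div_mul_eq_div]
  rfl

theorem tendsto_nS_div_nA (hA : AssignmentAssumption μ S W A πA) (s : 𝒮) :
    Tendsto (fun x => (observed W A S x).nS s / (observed W A S x).nA s) (inProb μ)
      (𝓝 (πA s)⁻¹) := by
  have h := hA.share_tendsto s
  rw [tendstoInProb_iff] at h
  refine (h.inv₀ (hA.target_mem s).1.ne').congr fun x => ?_
  rw [inv_div]
  rfl

theorem tendsto_nS_div_sub (hS : Measurable S) (hW : DataAssumption μ Q S W)
    (hA : AssignmentAssumption μ S W A πA) (s : 𝒮) :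
    Tendsto (fun x => (observed W A S x).nS s
      / ((observed W A S x).nS s - (observed W A S x).nA s)) (inProb μ) (𝓝 (1 - πA s)⁻¹) := by
  have hp := (hW.p_pos s).ne'
  have hπ : 1 - πA s ≠ 0 := (sub_pos.2 (hA.target_mem s).2).ne'
  have h := (tendsto_nS_div (A := A) hS hW s).div (tendsto_armMoment_zero hS hW hA false s)
    (mul_ne_zero (by simpa [assignProb] using hπ) hp)
  have hlim : p Q S s / (assignProb πA false s * p Q S s) = (1 - πA s)⁻¹ := by
    simp only [assignProb, Bool.false_eq_true, if_false]
    field_simp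
  rw [hlim] at h
  refine h.congr' ?_
  filter_upwards [eventually_size_ne_zero] with x hx
  rw [Sample.nA_eq, Sample.nS_eq, ← mul_sub, add_sub_cancel_left, Pi.div_apply, Sample.nS_eq]
  have : (x.1 : ℝ) ≠ 0 := by exact_mod_cast hx
  field_simp

theorem tendsto_probSCHat (hS : Measurable S) (hW : DataAssumption μ Q S W)
    (hA : AssignmentAssumption μ S W A πA) (s : 𝒮) :
    Tendsto (fun x => (observed W A S x).probSCHat s) (inProb μ)
      (𝓝 (p Q S s * (piD Q S true s - piD Q S false s))) :=
  (tendsto_nS_div hS hW s).mul ((tendsto_r1 hS hW hA s).sub (tendsto_r0 hS hW hA s))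

theorem tendsto_probCHat (hS : Measurable S) (hW : DataAssumption μ Q S W)
    (hA : AssignmentAssumption μ S W A πA) :
    Tendsto (fun x => (observed W A S x).probCHat) (inProb μ) (𝓝 (probC Q S)) :=
  tendsto_finsetSum _ fun s _ => tendsto_probSCHat hS hW hA s

theorem tendsto_one_div_probCHat_sq (hS : Measurable S) (hW : DataAssumption μ Q S W)
    (hA : AssignmentAssumption μ S W A πA) :
    Tendsto (fun x => 1 / (observed W A S x).probCHat ^ 2) (inProb μ) (𝓝 (1 / probC Q S ^ 2)) :=
  tendsto_const_nhds.div ((tendsto_probCHat hS hW hA).pow 2) (pow_ne_zero 2 (probC_pos hW).ne')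

theorem tendsto_betaHat (hS : Measurable S) (hW : DataAssumption μ Q S W)
    (hA : AssignmentAssumption μ S W A πA) :
    Tendsto (fun x => (observed W A S x).betaHat) (inProb μ) (𝓝 (late Q)) := by
  rw [late_eq hS hW]
  exact tendsto_finsetSum _ fun s _ => ((tendsto_probSCHat hS hW hA s).div
    (tendsto_probCHat hS hW hA) (probC_pos hW).ne').mul (tendsto_betaHatAt hS hW hA s)

theorem tendsto_cellMeanSq (hS : Measurable S) (hW : DataAssumption μ Q S W)
    (hA : AssignmentAssumption μ S W A πA) (d a : Bool) (s : 𝒮) {c : (Σ n, Ω n) → ℝ} {c₀ : ℝ}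
    (hc : Tendsto c (inProb μ) (𝓝 c₀)) {κ : ℝ}
    (hκ : κ = outcomeMean Q S true s - piD Q S true s * lateAt Q S s
      + (if d = true then 1 else 0) * lateAt Q S s - c₀) :
    Tendsto (fun x => (observed W A S x).cellMeanSq d a s (c x)) (inProb μ)
      (𝓝 (assignProb πA a s * (cellMean Q S 2 d a s - 2 * κ * cellMean Q S 1 d a s
        + κ ^ 2 * cellMean Q S 0 d a s))) := by
  have hk := (((tendsto_gammaHatAt hS hW hA s).add
    ((tendsto_betaHatAt hS hW hA s).const_mul (if d = true then (1 : ℝ) else 0))).sub hc)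
  rw [← hκ] at hk
  have h := ((tendsto_cellMoment hS hW hA le_rfl d a s).sub
    ((hk.const_mul 2).mul (tendsto_cellMoment hS hW hA one_le_two d a s))).add
    ((hk.pow 2).mul (tendsto_cellMoment hS hW hA (Nat.zero_le 2) d a s))
  have hlim : assignProb πA a s * cellMean Q S 2 d a s
      - 2 * κ * (assignProb πA a s * cellMean Q S 1 d a s)
      + κ ^ 2 * (assignProb πA a s * cellMean Q S 0 d a s)
      = assignProb πA a s * (cellMean Q S 2 d a s - 2 * κ * cellMean Q S 1 d a s
        + κ ^ 2 * cellMean Q S 0 d a s) := by ring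
  rw [hlim] at h
  exact h.congr fun x => (Sample.cellMeanSq_eq d a s (c x) _ rfl).symm

theorem tendsto_V1Hat (hS : Measurable S) (hW : DataAssumption μ Q S W)
    (hA : AssignmentAssumption μ S W A πA) :
    Tendsto (fun x => (observed W A S x).V1Hat) (inProb μ)
      (𝓝 (VY1 Q S πA + VD1 Q S πA)) := by
  have hδ : ∀ s, Tendsto (fun x => (observed W A S x).betaHatAt s - (observed W A S x).betaHat)
      (inProb μ) (𝓝 (lateAt Q S s - late Q)) := fun s =>
    (tendsto_betaHatAt hS hW hA s).sub (tendsto_betaHat hS hW hA)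
  have h := (tendsto_one_div_probCHat_sq hS hW hA).mul
    (tendsto_finsetSum Finset.univ fun s _ => ((tendsto_nS_div_nA hA s).pow 2).mul
      ((tendsto_cellMeanSq hS hW hA true true s
        (((tendsto_r1 hS hW hA s).const_sub 1).mul (hδ s)) rfl).add
       (tendsto_cellMeanSq hS hW hA false true s ((tendsto_r1 hS hW hA s).mul (hδ s)).neg rfl)))
  -- What remains is the law of total variance for Y(D(1)) - β D(1) in each stratum: the values of κ
  -- are m₁ + (1 - π₁)β for the treated and m₁ - π₁β for the untreated. One factor π_A(s) of the
  -- cell limits cancels against the squared weight.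
  refine (h.congr fun x => rfl).trans (le_of_eq (congrArg 𝓝 ?_))
  rw [VY1, VD1, ← mul_add, ← Finset.sum_add_distrib]
  congr 1
  refine Finset.sum_congr rfl fun s _ => ?_
  have hπ := (hA.target_mem s).1.ne'
  have hp := (hW.p_pos s).ne'
  have h0 : 0 ≤ piD Q S false s := measureReal_nonneg
  -- The complier share is positive, so this denominator is nonzero even when there are no always
  -- takers.
  have h1 : piD Q S true s ≠ 0 := by linarith [hW.compliers_pos s]
  rw [cellMean_true_true hS hW le_rfl, cellMean_true_true hS hW one_le_two,
    cellMean_zero_true hS hW, cellMean_false_true hS hW le_rfl,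
    cellMean_false_true hS hW one_le_two, cellMean_zero_false hS hW, lateAt_eq hS hW]
  simp only [typeMoment, outcomeMean, assignProb, if_true]
  field_simp
  simp
  ring

theorem tendsto_V0Hat (hS : Measurable S) (hW : DataAssumption μ Q S W)
    (hA : AssignmentAssumption μ S W A πA) :
    Tendsto (fun x => (observed W A S x).V0Hat) (inProb μ)
      (𝓝 (VY0 Q S πA + VD0 Q S πA)) := by
  have hδ : ∀ s, Tendsto (fun x => (observed W A S x).betaHatAt s - (observed W A S x).betaHat)
      (inProb μ) (𝓝 (lateAt Q S s - late Q)) := fun s =>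
    (tendsto_betaHatAt hS hW hA s).sub (tendsto_betaHat hS hW hA)
  have h := (tendsto_one_div_probCHat_sq hS hW hA).mul
    (tendsto_finsetSum Finset.univ fun s _ => ((tendsto_nS_div_sub hS hW hA s).pow 2).mul
      ((tendsto_cellMeanSq hS hW hA true false s
        (((tendsto_r0 hS hW hA s).const_sub 1).mul (hδ s)) rfl).add
       (tendsto_cellMeanSq hS hW hA false false s ((tendsto_r0 hS hW hA s).mul (hδ s)).neg rfl)))
  -- The same variance decomposition for Y(D(0)) - β D(0). The intercept was written with the
  -- treated arm, and the Wald identity m₁ - π₁β(s) = m₀ - π₀β(s) recentres it at the control arm.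
  refine (h.congr fun x => rfl).trans (le_of_eq (congrArg 𝓝 ?_))
  rw [VY0, VD0, ← mul_add, ← Finset.sum_add_distrib]
  congr 1
  refine Finset.sum_congr rfl fun s _ => ?_
  have hπ : 1 - πA s ≠ 0 := (sub_pos.2 (hA.target_mem s).2).ne'
  have hp := (hW.p_pos s).ne'
  have h0 : piD Q S true s ≤ 1 := by
    have := cond_isProbabilityMeasure (μ := Q) (s := inStratum S s) (fun h => hp (by
      simp [p, measureReal_def, h]))
    exact measureReal_le_one
  have h1 : 1 - piD Q S false s ≠ 0 := by linarith [hW.compliers_pos s]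
  rw [cellMean_false_false hS hW le_rfl, cellMean_false_false hS hW one_le_two,
    cellMean_zero_true hS hW, cellMean_true_false hS hW le_rfl,
    cellMean_true_false hS hW one_le_two, cellMean_zero_false hS hW, lateAt_eq hS hW]
  simp only [typeMoment, outcomeMean, assignProb]
  field_simp
  simp
  ring

theorem tendsto_VHHat (hS : Measurable S) (hW : DataAssumption μ Q S W)
    (hA : AssignmentAssumption μ S W A πA) :
    Tendsto (fun x => (observed W A S x).VHHat) (inProb μ) (𝓝 (VH Q S)) :=
  (tendsto_one_div_probCHat_sq hS hW hA).mul
    (tendsto_finsetSum Finset.univ fun s _ => ((tendsto_nS_div hS hW s).mul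
      (((tendsto_r1 hS hW hA s).sub (tendsto_r0 hS hW hA s)).pow 2)).mul
      (((tendsto_betaHatAt hS hW hA s).sub (tendsto_betaHat hS hW hA)).pow 2))

end Limits

end SatIV

theorem mainTheorem2 {𝒵 𝒮 : Type*} [MeasurableSpace 𝒵]
    [Fintype 𝒮] [DecidableEq 𝒮] [MeasurableSpace 𝒮] [MeasurableSingletonClass 𝒮]
    (S : 𝒵 → 𝒮) (hS : Measurable S)
    (Q : Measure (SatIV.Participant 𝒵)) [IsProbabilityMeasure Q]
    {Ω : ℕ → Type*} [∀ n, MeasurableSpace (Ω n)]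
    (μ : ∀ n, Measure (Ω n)) [∀ n, IsProbabilityMeasure (μ n)]
    (W : ∀ n, Ω n → Fin n → SatIV.Participant 𝒵) (A : ∀ n, Ω n → Fin n → Bool)
    (πA : 𝒮 → ℝ)
    (hW : SatIV.DataAssumption μ Q S W)
    (hA : SatIV.AssignmentAssumption μ S W A πA) :
    SatIV.TendstoInProb μ (fun n ω => (SatIV.observe S (W n ω) (A n ω)).VsatHat)
      (SatIV.Vsat Q S πA) := by
  rw [SatIV.tendstoInProb_iff]
  have h := ((SatIV.tendsto_V1Hat hS hW hA).add (SatIV.tendsto_V0Hat hS hW hA)).add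
    (SatIV.tendsto_VHHat hS hW hA)
  have hlim : SatIV.VY1 Q S πA + SatIV.VD1 Q S πA + (SatIV.VY0 Q S πA + SatIV.VD0 Q S πA)
      + SatIV.VH Q S = SatIV.Vsat Q S πA := by
    rw [SatIV.Vsat]
    ring
  rw [hlim] at h
  exact h
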